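/- Let $\mathbb T$ be the unit circle with normalized arc length measure, $H^2$ the closed subspace of $L^2=L^2(\mathbb T)$ of functions whose negative Fourier coefficients vanish, $P_+$ the orthogonal projection of $L^2$ onto $H^2$, $P_-=I-P_+$, and $H^\infty=L^\infty\cap H^2$. For a matrix symbol $H=\begin{bmatrix} f&u\\ g&v\end{bmatrix}$ with entries in $L^\infty$, the generalized Cauchy singular integral operator (GSIO) $R_H$ on $L^2$ is $$R_Hx=P_+fP_+x+P_-gP_+x+P_+uP_-x+P_-vP_-x .$$ For $h\in L^\infty$ write $h_-=P_-h$; let $Vx=\bar z\bar x$ for $x\in L^2$; and for $p,q\in L^2\oplus L^2$ let $(p\otimes q)(x)=\langle x,q\rangle p$. **Theorem.** Let $H_i=\begin{bmatrix} f_i&u_i\\ g_i&v_i\end{bmatrix}$ ($i=1,2$) have entries in $L^\infty$, and assume that each of the two operators $$\binom{V(\bar f_1)_-}{g_{1-}}\otimes\binom{Vf_{2-}}{(\bar u_2)_-}-\binom{V(\bar u_1)_-}{v_{1-}}\otimes\binom{Vg_{2-}}{(\bar v_2)_-},\qquad \binom{V(\bar f_2)_-}{g_{2-}}\otimes\binom{Vf_{1-}}{(\bar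 u_1)_-}-\binom{V(\bar u_2)_-}{v_{2-}}\otimes\binom{Vg_{1-}}{(\bar v_1)_-}$$ on $L^2\oplus L^2$ has rank one. Then $R_{H_1}R_{H_2}=R_{H_2}R_{H_1}$ if and only if for at least one of the following sixteen lists there exist constants $\lambda,\mu,\alpha\in\mathbb C$ with $\alpha\neq0$ such that all ten functions in the list belong to $H^\infty$. (1) $\bar f_1 - \bar\lambda \bar u_1$, $g_1 - \lambda v_1$, $\bar f_2 - \bar\mu \bar u_2$, $g_2 - \mu v_2$, $\bar u_1 - \bar\alpha \bar u_2$, $v_1 - \alpha v_2$, $\mu f_1 - g_1 - \alpha (\lambda f_2 - g_2)$, $\bar\mu \bar u_1 - \bar v_1 - \bar\alpha (\bar\lambda \bar u_2 - \bar v_2)$, $g_2 (v_1 - \alpha v_2) + v_2 (\alpha \lambda f_2 - \mu f_1)$, $\bar u_2 \bar f_1 - \bar u_1 \bar f_2 + \bar\mu \bar u_1 \bar u_2 - \bar v_1 \bar u_2 + \bar\alpha \bar v_2 \bar u_2 - \bar\lambda \bar\alpha (\bar u_2)^2$. (2) $\bar u_1 - \bar\lambda \bar f_1$, $v_1 - \lambda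 g_1$, $\bar f_2 - \bar\mu \bar u_2$, $g_2 - \mu v_2$, $\bar f_1 - \bar\alpha \bar u_2$, $g_1 - \alpha v_2$, $\mu f_1 - g_1 - \alpha (f_2 - \lambda g_2)$, $\bar\mu \bar u_1 - \bar v_1 - \bar\alpha (\bar u_2 - \bar\lambda \bar v_2)$, $g_2 (v_1 - \lambda \alpha v_2) + v_2 (\alpha f_2 - \mu f_1)$, $\bar u_2 \bar f_1 - \bar u_1 \bar f_2 - \bar\alpha (\bar u_2)^2 + \bar\lambda \bar\alpha \bar v_2 \bar u_2 + \bar\mu \bar u_1 \bar u_2 - \bar v_1 \bar u_2$. (3) $f_2 - \bar\lambda g_2$, $\bar u_2 - \lambda \bar v_2$, $\bar f_2 - \bar\mu \bar u_2$, $g_2 - \mu v_2$, $\lambda \bar f_1 - \bar u_1 - \bar\alpha \bar u_2$, $\bar\lambda g_1 - v_1 - \alpha v_2$, $\mu f_1 - g_1 - \alpha g_2$, $\bar\mu \bar u_1 - \bar v_1 - \bar\alpha \bar v_2$, $g_1 f_2 + v_1 g_2 - \bar\lambda g_1 g_2 + \alpha v_2 g_2 - \mu v_2 f_1$, $\lambda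 \bar v_2 \bar f_1 + \bar\mu \bar u_1 \bar u_2 - \bar v_1 \bar u_2 - \bar\alpha \bar v_2 \bar u_2 - \bar u_1 \bar f_2$. (4) $g_2 - \bar\lambda f_2$, $\bar v_2 - \lambda \bar u_2$, $\bar f_2 - \bar\mu \bar u_2$, $g_2 - \mu v_2$, $\bar f_1 - \lambda \bar u_1 - \bar\alpha \bar u_2$, $g_1 - \bar\lambda v_1 - \alpha v_2$, $\mu f_1 - g_1 - \alpha f_2$, $\bar\mu \bar u_1 - \bar v_1 - \bar\alpha \bar u_2$, $\bar\lambda v_1 f_2 - \mu v_2 f_1 + \alpha v_2 f_2$, $\bar v_2 \bar u_1 - \bar u_1 \bar f_2 + \bar u_2 \bar f_1 - \lambda \bar u_1 \bar u_2 + \bar\mu \bar u_1 \bar u_2 - \bar u_2 \bar v_1 - \bar\alpha (\bar u_2)^2$. (5) $\bar f_1 - \bar\lambda \bar u_1$, $g_1 - \lambda v_1$, $\bar u_2 - \bar\mu \bar f_2$, $v_2 - \mu g_2$, $\bar u_1 - \bar\alpha \bar f_2$, $v_1 - \alpha g_2$, $f_1 - \mu g_1 - \alpha (\lambda f_2 -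 g_2)$, $\bar u_1 - \bar\mu \bar v_1 - \bar\alpha (\bar\lambda \bar u_2 - \bar v_2)$, $\bar u_2 \bar f_1 - \bar\mu \bar v_1 \bar f_2 + \bar\alpha \bar v_2 \bar f_2 - \bar\lambda \bar\alpha \bar u_2 \bar f_2$, $v_1 g_2 - v_2 g_1 - f_1 g_2 + \mu g_1 g_2 - \alpha g_2^2 + \lambda \alpha g_2 f_2$. (6) $\bar u_1 - \bar\lambda \bar f_1$, $v_1 - \lambda g_1$, $\bar u_2 - \bar\mu \bar f_2$, $v_2 - \mu g_2$, $\bar f_1 - \bar\alpha \bar f_2$, $g_1 - \alpha g_2$, $f_1 - \mu g_1 - \alpha (f_2 - \lambda g_2)$, $\bar u_1 - \bar\mu \bar v_1 - \bar\alpha (\bar u_2 - \bar\lambda \bar v_2)$, $\bar u_2 \bar f_1 - \bar\mu \bar v_1 \bar f_2 - \bar\alpha \bar u_2 \bar f_2 + \bar\lambda \bar\alpha \bar v_2 \bar f_2$, $v_1 g_2 - v_2 g_1 - g_2 f_1 + \mu g_1 g_2 + \alpha g_2 f_2 - \lambda \alpha g_2^2$. (7) $f_2 - \bar\lambda g_2$,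 $\bar u_2 - \lambda \bar v_2$, $\bar u_2 - \bar\mu \bar f_2$, $v_2 - \mu g_2$, $\lambda \bar f_1 - \bar u_1 - \bar\alpha \bar f_2$, $\bar\lambda g_1 - v_1 - \alpha g_2$, $f_1 - \mu g_1 - \alpha g_2$, $\bar u_1 - \bar\mu \bar v_1 - \bar\alpha \bar v_2$, $\lambda \bar v_2 \bar f_1 - \bar\mu \bar v_1 \bar f_2 - \bar\alpha \bar v_2 \bar f_2$, $g_1 f_2 - v_2 g_1 + (v_1 - \bar\lambda g_1) g_2 + g_2 (\mu g_1 - f_1) + \alpha g_2^2$. (8) $g_2 - \bar\lambda f_2$, $\bar v_2 - \lambda \bar u_2$, $\bar u_2 - \bar\mu \bar f_2$, $v_2 - \mu g_2$, $\bar f_1 - \lambda \bar u_1 - \bar\alpha \bar f_2$, $g_1 - \bar\lambda v_1 - \alpha g_2$, $f_1 - \mu g_1 - \alpha f_2$, $\bar u_1 - \bar\mu \bar v_1 - \bar\alpha \bar u_2$, $\bar v_2 \bar u_1 + \bar u_2 \bar f_1 - \lambda \bar u_1 \bar u_2 - \bar\mu \bar v_1 \bar f_2 - \bar\alpha \bar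 u_2 \bar f_2$, $g_1 v_2 + g_2 f_1 - \bar\lambda v_1 f_2 - \mu g_1 g_2 - \alpha g_2 f_2$. (9) $\bar f_1 - \bar\lambda \bar u_1$, $g_1 - \lambda v_1$, $f_1 - \bar\mu g_1$, $\bar u_1 - \mu \bar v_1$, $\bar u_1 - \bar\alpha (\mu \bar f_2 - \bar u_2)$, $v_1 - \alpha (\bar\mu g_2 - v_2)$, $g_1 - \alpha (\lambda f_2 - g_2)$, $\bar v_1 - \bar\alpha (\bar\lambda \bar u_2 - \bar v_2)$, $\bar u_2 \bar f_1 - \bar v_1 \bar u_2 + \bar\alpha (\bar\lambda \bar u_2 - \bar v_2) (\bar u_2 - \mu \bar f_2)$, $v_1 g_2 - g_2 f_1 + \alpha (\bar\mu g_2 - v_2) (\lambda f_2 - g_2)$. (10) $\bar u_1 - \bar\lambda \bar f_1$, $v_1 - \lambda g_1$, $f_1 - \bar\mu g_1$, $\bar u_1 - \mu \bar v_1$, $\bar f_1 - \bar\alpha (\mu \bar f_2 - \bar u_2)$, $g_1 - \alpha (\bar\mu g_2 - v_2)$, $g_1 - \alpha (f_2 - \lambda g_2)$, $\bar v_1 -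 \bar\alpha (\bar u_2 - \bar\lambda \bar v_2)$, $\bar u_2 \bar f_1 - \bar v_1 \bar u_2 + \bar\alpha (\bar\lambda \bar v_2 - \bar u_2) (\mu \bar f_2 - \bar u_2)$, $v_1 g_2 - g_2 f_1 + \alpha (\bar\mu g_2 - v_2) (f_2 - \lambda g_2)$. (11) $f_2 - \bar\lambda g_2$, $\bar u_2 - \lambda \bar v_2$, $f_1 - \bar\mu g_1$, $\bar u_1 - \mu \bar v_1$, $\lambda \bar f_1 - \bar u_1 - \bar\alpha (\mu \bar f_2 - \bar u_2)$, $\bar\lambda g_1 - v_1 - \alpha (\bar\mu g_2 - v_2)$, $g_1 - \alpha g_2$, $\bar v_1 - \bar\alpha \bar v_2$, $\bar v_1 \bar u_2 - \lambda \bar v_2 \bar f_1 - \bar\alpha \bar v_2 \bar u_2 + \bar\alpha \mu \bar v_2 \bar f_2$, $g_1 f_2 - g_2 f_1 + (v_1 - \bar\lambda g_1) g_2 + \alpha g_2 (\bar\mu g_2 - v_2)$. (12) $g_2 - \bar\lambda f_2$, $\bar v_2 - \lambda \bar u_2$, $f_1 - \bar\mu g_1$, $\bar u_1 - \mu \bar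 v_1$, $\bar f_1 - \lambda \bar u_1 - \bar\alpha (\mu \bar f_2 - \bar u_2)$, $g_1 - \bar\lambda v_1 - \alpha (\bar\mu g_2 - v_2)$, $g_1 - \alpha f_2$, $\bar v_1 - \bar\alpha \bar u_2$, $\bar v_2 \bar u_1 - \bar v_1 \bar u_2 + \bar u_2 (\bar f_1 - \lambda \bar u_1) + \bar\alpha \bar u_2 (\bar u_2 - \mu \bar f_2)$, $g_2 f_1 - \bar\lambda v_1 f_2 - \bar\mu \alpha f_2 g_2 + \alpha v_2 f_2$. (13) $\bar f_1 - \bar\lambda \bar u_1$, $g_1 - \lambda v_1$, $g_1 - \bar\mu f_1$, $\bar v_1 - \mu \bar u_1$, $\bar u_1 - \bar\alpha (\bar f_2 - \mu \bar u_2)$, $v_1 - \alpha (g_2 - \bar\mu v_2)$, $f_1 - \alpha (\lambda f_2 - g_2)$, $\bar u_1 - \bar\alpha (\bar\lambda \bar u_2 - \bar v_2)$, $\bar u_2 \bar f_1 - \bar v_1 \bar u_2 + \bar\alpha (\bar v_2 - \bar\lambda \bar u_2) (\bar f_2 - \mu \bar u_2)$, $v_1 g_2 - g_2 f_1 + \alpha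 (g_2 - \bar\mu v_2) (\lambda f_2 - g_2)$. (14) $\bar u_1 - \bar\lambda \bar f_1$, $v_1 - \lambda g_1$, $g_1 - \bar\mu f_1$, $\bar v_1 - \mu \bar u_1$, $\bar f_1 - \bar\alpha (\bar f_2 - \mu \bar u_2)$, $g_1 - \alpha (g_2 - \bar\mu v_2)$, $f_1 - \alpha (f_2 - \lambda g_2)$, $\bar u_1 - \bar\alpha (\bar u_2 - \bar\lambda \bar v_2)$, $(\bar f_1 - \bar v_1) \bar u_2 + \bar\alpha (\bar\lambda \bar v_2 - \bar u_2) (\bar f_2 - \mu \bar u_2)$, $(v_1 - f_1) g_2 + \alpha (g_2 - \bar\mu v_2) (f_2 - \lambda g_2)$. (15) $f_2 - \bar\lambda g_2$, $\bar u_2 - \lambda \bar v_2$, $g_1 - \bar\mu f_1$, $\bar v_1 - \mu \bar u_1$, $\lambda \bar f_1 - \bar u_1 - \bar\alpha (\bar f_2 - \mu \bar u_2)$, $\bar\lambda g_1 - v_1 - \alpha (g_2 - \bar\mu v_2)$, $f_1 - \alpha g_2$, $\bar u_1 - \bar\alpha \bar v_2$, $\bar v_1 \bar u_2 - \lambda \bar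 f_1 \bar v_2 - \bar\alpha \bar v_2 (\mu \bar u_2 - \bar f_2)$, $g_1 f_2 - g_2 f_1 + (v_1 - \bar\lambda g_1) g_2 + \alpha g_2 (g_2 - \bar\mu v_2)$. (16) $g_2 - \bar\lambda f_2$, $\bar v_2 - \lambda \bar u_2$, $g_1 - \bar\mu f_1$, $\bar v_1 - \mu \bar u_1$, $\bar f_1 - \lambda \bar u_1 - \bar\alpha (\bar f_2 - \mu \bar u_2)$, $g_1 - \bar\lambda v_1 - \alpha (g_2 - \bar\mu v_2)$, $f_1 - \alpha f_2$, $\bar u_1 - \bar\alpha \bar u_2$, $\bar u_1 \bar v_2 - \bar v_1 \bar u_2 + \bar u_2 (\bar f_1 - \lambda \bar u_1) + \bar\alpha \bar u_2 (\mu \bar u_2 - \bar f_2)$, $f_1 g_2 - \bar\lambda v_1 f_2 + \alpha f_2 (\bar\mu v_2 - g_2)$. -/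

import Mathlib

open MeasureTheory
open scoped ENNReal

noncomputable section

namespace GSIO

/-- The unit circle, parametrized by `θ ∈ ℝ/ℤ` through `z = exp (2πiθ)`; under this parametrization
the monomial `z ^ n` is `fourier n`, and the normalized arc length measure is
`AddCircle.haarAddCircle`. -/
abbrev Torus : Type := UnitAddCircle

/-- Normalized arc length measure on the unit circle. -/
abbrev arc : Measure Torus := AddCircle.haarAddCircle

/-- The Hilbert space `L²` of the unit circle. -/
abbrev L2 : Type := Lp ℂ 2 arc

/-- `L^∞` of the unit circle: the star algebra of essentially bounded, almost everywhere strongly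
measurable functions, with pointwise operations; `star f` is the complex conjugate of `f`. Everything
below depends on such a function only up to almost everywhere equality. -/
def LInf : StarSubalgebra ℂ (Torus → ℂ) where
  carrier := {f | MemLp f ∞ arc}
  mul_mem' {f g} hf hg := by
    have h : MemLp (g * f) ∞ arc := MemLp.mul' (p := ∞) (q := ∞) hf hg
    rwa [mul_comm] at h
  add_mem' hf hg := MemLp.add hf hg
  algebraMap_mem' c := memLp_top_const c
  star_mem' hf := MemLp.star hf

theorem memLp_top (f : LInf) : MemLp (f : Torus → ℂ) ∞ arc := f.2

theorem memLp_two (f : LInf) : MemLp (f : Torus → ℂ) 2 arc :=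
  (memLp_top f).mono_exponent le_top

/-- The inclusion of `L^∞` into `L²`. -/
def toL2 : LInf →ₗ[ℂ] L2 where
  toFun f := (memLp_two f).toLp _
  map_add' f g := MemLp.toLp_add (memLp_two f) (memLp_two g)
  map_smul' c f := MemLp.toLp_const_smul c (memLp_two f)

theorem coeFn_toL2 (f : LInf) : (toL2 f : Torus → ℂ) =ᵐ[arc] f := MemLp.coeFn_toLp (memLp_two f)

/-- The Hardy space `H²`: the functions in `L²` whose negative Fourier coefficients vanish. -/
def H2 : Submodule ℂ L2 where
  carrier := {x | ∀ n : ℤ, n < 0 → fourierCoeff (x : Torus → ℂ) n = 0}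
  zero_mem' n _ := by rw [← fourierBasis_repr]; simp
  add_mem' {x y} hx hy n hn := by
    have h1 := hx n hn
    have h2 := hy n hn
    rw [← fourierBasis_repr] at h1 h2 ⊢
    simp [h1, h2]
  smul_mem' c x hx n hn := by
    have h1 := hx n hn
    rw [← fourierBasis_repr] at h1 ⊢
    simp [h1]

theorem isClosed_H2 : IsClosed (H2 : Set L2) := by
  have h : (H2 : Set L2) = ⋂ n : ℤ, ⋂ _ : n < 0, {x : L2 | fourierBasis.repr x n = 0} := by
    ext x
    simp [H2, fourierBasis_repr]
  rw [h]
  refine isClosed_iInter fun n => isClosed_iInter fun _ => isClosed_eq ?_ continuous_const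
  have : (fun x : L2 => fourierBasis.repr x n) = fun x => inner ℂ (fourierBasis n) x := by
    funext x
    exact fourierBasis.repr_apply_apply x n
  rw [this]
  fun_prop

instance : CompleteSpace H2 := isClosed_H2.completeSpace_coe

/-- The orthogonal projection of `L²` onto `H²`. -/
def Pplus : L2 →L[ℂ] L2 := H2.starProjection

/-- `P₋ = I - P₊`. -/
def Pminus : L2 →L[ℂ] L2 := ContinuousLinearMap.id ℂ L2 - Pplus

/-- `H^∞ = L^∞ ∩ H²`. -/
def HInf : Submodule ℂ LInf := H2.comap toL2

/-- All the members of `S` lie in `H^∞`. -/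
def InHInf (S : Set LInf) : Prop := ∀ φ ∈ S, φ ∈ HInf

/-- The operator of multiplication by `f` on `L²`. -/
def mulOp (f : LInf) : L2 →L[ℂ] L2 :=
  (ContinuousLinearMap.mul ℂ ℂ).holderL arc ∞ 2 2 ((memLp_top f).toLp _)

theorem coeFn_mulOp (f : LInf) (x : L2) :
    (mulOp f x : Torus → ℂ) =ᵐ[arc] fun t => (f : Torus → ℂ) t * x t := by
  have h := (ContinuousLinearMap.mul ℂ ℂ).coeFn_holder (r := 2) ((memLp_top f).toLp _) x
  filter_upwards [h, (memLp_top f).coeFn_toLp] with t h1 h2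
  rw [h2] at h1
  exact h1

/-- The generalized Cauchy singular integral operator with the matrix symbol
`H = !![f, u; g, v]`: `R_H x = P₊ f P₊ x + P₋ g P₊ x + P₊ u P₋ x + P₋ v P₋ x`. -/
def gsio (H : Matrix (Fin 2) (Fin 2) LInf) : L2 →L[ℂ] L2 :=
  Pplus ∘L mulOp (H 0 0) ∘L Pplus + Pminus ∘L mulOp (H 1 0) ∘L Pplus
    + Pplus ∘L mulOp (H 0 1) ∘L Pminus + Pminus ∘L mulOp (H 1 1) ∘L Pminus

/-- The function `z̄` on the circle. -/
def zbar : LInf :=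
  ⟨fun t => fourier (-1) t,
    MemLp.of_bound (fourier (-1)).continuous.aestronglyMeasurable 1 (by
      filter_upwards with t
      exact (Circle.norm_coe _).le)⟩

/-- The anti-unitary operator `V x = z̄ x̄` on `L²`. -/
def V (x : L2) : L2 := mulOp zbar (star x)

/-- `f₋ = P₋ f` for `f ∈ L^∞`. -/
def neg (f : LInf) : L2 := Pminus (toL2 f)

/-- The Hilbert space of columns of two `L²` functions. -/
abbrev L2Col : Type := WithLp 2 (L2 × L2)

/-- The column with entries `p` and `q`. -/
def col (p q : L2) : L2Col := WithLp.toLp 2 (p, q)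

/-- `(p ⊗ q) x = ⟨x, q⟩ p` (the inner product here being linear in its first argument). -/
def tensor (p q : L2Col) : L2Col →L[ℂ] L2Col := InnerProductSpace.rankOne ℂ p q

theorem tensor_apply (p q x : L2Col) : tensor p q x = inner ℂ q x • p := by
  simp [tensor]

/-- The operator
`(V(f̄)₋, g₋) ⊗ (Vf'₋, (ū')₋) - (V(ū)₋, v₋) ⊗ (Vg'₋, (v̄')₋)`
for the symbols `H = !![f, u; g, v]` and `H' = !![f', u'; g', v']`. -/
def W (H H' : Matrix (Fin 2) (Fin 2) LInf) : L2Col →L[ℂ] L2Col :=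
  tensor (col (V (neg (star (H 0 0)))) (neg (H 1 0)))
      (col (V (neg (H' 0 0))) (neg (star (H' 0 1))))
    - tensor (col (V (neg (star (H 0 1)))) (neg (H 1 1)))
      (col (V (neg (H' 1 0))) (neg (star (H' 1 1))))

/-- An operator has rank one if its range is one-dimensional. -/
def IsRankOne (T : L2Col →L[ℂ] L2Col) : Prop :=
  Module.finrank ℂ (LinearMap.range (T : L2Col →ₗ[ℂ] L2Col)) = 1

end GSIO

end

/-!
Write `R_H R_H' - R_H' R_H` as a matrix with respect to the monomials `z ^ n`. In each of the four
quadrants `± × ±` its entry at `(m, n)` is given by one formula, a difference of entries of operators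
`a P₊ b + c P₋ d`. Since `P₊ z - z P₊` is the rank one operator `z̄ ↦ 1`, the increment of such an
entry from `(m, n)` to `(m + 1, n + 1)` is a difference of products of Fourier coefficients
(`entry_succ`), and the vanishing of all increments within the quadrants is the tensor
equation `W H H' = W H' H` (`W_eq_W_iff`). In the quadrants `++` and `--` the diagonals run off to infinity, where the entries
tend to zero because the Toeplitz parts cancel and Hankel operators decay along the shift; in the
two mixed quadrants the entries are constant along diagonals and hence determined by their values at
`1` and at `z̄`. So the operators commute if and only if the tensor equation holds and two functions,
`lowerCorner` and `upperCorner`, are symmetric in `H` and `H'` (`commute_iff`).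

An operator `p₁ ⊗ q₁ - p₂ ⊗ q₂` of rank one has proportional `p₁, p₂` or proportional `q₁, q₂`, which
leaves four possibilities (`Degeneration`), each turning it into an elementary tensor. With four
possibilities for `W H H'` and four for `W H' H` there are sixteen cases, and the equality of two
nonzero elementary tensors supplies the constant `α ≠ 0`. All these relations are linear relations
modulo `H^∞` between the symbols. The corners are expressed by the Hankel forms `P₋(a P₋ b)`,
to which the same relations apply: the Hankel forms cancel and the corner conditions
become the membership of `lowerSymbol` and `upperSymbol` in `H^∞` (`Degeneration.Match.commute_iff`).
Up to sign these are the last two functions of each list.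
-/

noncomputable section

namespace GSIO

/-! ### Fourier coefficients, projections and multiplication operators -/

/-- The `n`-th Fourier coefficient, as a continuous linear functional on `L²`. -/
def coef (n : ℤ) : L2 →L[ℂ] ℂ := innerSL ℂ (fourierLp 2 n : L2)

/-- The monomial `z ^ n` in `L²`. -/
def mono (n : ℤ) : L2 := fourierLp 2 n

theorem coef_eq_repr (n : ℤ) (x : L2) : coef n x = fourierBasis.repr x n := by
  rw [fourierBasis.repr_apply_apply, coe_fourierBasis]; rfl

theorem coef_eq_fourierCoeff (n : ℤ) (x : L2) : coef n x = fourierCoeff (x : Torus → ℂ) n := by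
  rw [coef_eq_repr, fourierBasis_repr]

theorem coef_mono (n m : ℤ) : coef n (mono m) = if n = m then 1 else 0 :=
  (orthonormal_iff_ite.1 (orthonormal_fourier (T := 1))) n m

theorem ext_coef {x y : L2} (h : ∀ n, coef n x = coef n y) : x = y := by
  apply fourierBasis.repr.injective
  ext n
  simpa [coef_eq_repr] using h n

theorem mem_H2_iff (x : L2) : x ∈ H2 ↔ ∀ n : ℤ, n < 0 → coef n x = 0 := by
  simp only [coef_eq_fourierCoeff]; rfl

theorem mono_mem_H2 {n : ℤ} (hn : 0 ≤ n) : mono n ∈ H2 := by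
  rw [mem_H2_iff]
  intro m hm
  rw [coef_mono, if_neg (by omega)]

theorem coef_Pplus (n : ℤ) (x : L2) : coef n (Pplus x) = if 0 ≤ n then coef n x else 0 := by
  split_ifs with hn
  · have h := H2.starProjection_inner_eq_zero x (mono n) (mono_mem_H2 hn)
    have h2 : inner ℂ (mono n) (x - H2.starProjection x) = 0 := by
      rw [← inner_conj_symm, h, map_zero]
    rw [inner_sub_right, sub_eq_zero] at h2
    exact h2.symm
  · exact (mem_H2_iff _).1 (H2.starProjection_apply_mem x) n (by omega)

theorem Pminus_apply (x : L2) : Pminus x = x - Pplus x := rfl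

theorem coef_Pminus (n : ℤ) (x : L2) : coef n (Pminus x) = if n < 0 then coef n x else 0 := by
  rw [Pminus_apply, map_sub, coef_Pplus]
  split_ifs <;> first | omega | simp

theorem Pplus_add_Pminus (x : L2) : Pplus x + Pminus x = x := by
  simp [Pminus]

theorem Pminus_eq_zero_iff (x : L2) : Pminus x = 0 ↔ x ∈ H2 := by
  rw [mem_H2_iff]
  constructor
  · intro h n hn
    have := congrArg (coef n) h
    simpa [coef_Pminus, hn] using this
  · intro h
    apply ext_coef; intro n
    rw [coef_Pminus]
    split_ifs with hn
    · simp [h n hn]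
    · simp

theorem Pplus_mono {n : ℤ} (hn : 0 ≤ n) : Pplus (mono n) = mono n := by
  apply ext_coef; intro m; rw [coef_Pplus, coef_mono]; split_ifs <;> first | omega | rfl

theorem Pminus_mono {n : ℤ} (hn : 0 ≤ n) : Pminus (mono n) = 0 :=
  (Pminus_eq_zero_iff _).2 (mono_mem_H2 hn)

theorem Pplus_mono_neg {n : ℤ} (hn : n < 0) : Pplus (mono n) = 0 := by
  apply ext_coef; intro m; rw [coef_Pplus, coef_mono]; split_ifs <;> first | omega | simp

theorem Pminus_mono_neg {n : ℤ} (hn : n < 0) : Pminus (mono n) = mono n := by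
  apply ext_coef; intro m; rw [coef_Pminus, coef_mono]; split_ifs <;> first | omega | rfl

/-- Operators on `L²` that agree on all monomials are equal. -/
theorem ext_mono {F : Type*} [NormedAddCommGroup F] [NormedSpace ℂ F] {S T : L2 →L[ℂ] F}
    (h : ∀ n, S (mono n) = T (mono n)) : S = T := by
  refine ContinuousLinearMap.ext_on (s := Set.range (fourierLp (T := 1) 2)) ?_ ?_
  · refine Submodule.dense_iff_topologicalClosure_eq_top.2 ?_
    exact span_fourierLp_closure_eq_top (by simp)
  · rintro _ ⟨n, rfl⟩
    exact h n

theorem mulOp_mul (a b : LInf) (x : L2) : mulOp (a * b) x = mulOp a (mulOp b x) := by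
  apply Lp.ext
  filter_upwards [coeFn_mulOp (a * b) x, coeFn_mulOp a (mulOp b x), coeFn_mulOp b x] with t h1 h2 h3
  rw [h1, h2, h3]
  simp [mul_assoc]

theorem mulOp_add (a b : LInf) (x : L2) : mulOp (a + b) x = mulOp a x + mulOp b x := by
  apply Lp.ext
  filter_upwards [coeFn_mulOp (a + b) x, coeFn_mulOp a x, coeFn_mulOp b x,
    Lp.coeFn_add (mulOp a x) (mulOp b x)] with t h1 h2 h3 h4
  rw [h1, h4, Pi.add_apply, h2, h3]
  simp [add_mul]

theorem mulOp_smul (c : ℂ) (a : LInf) (x : L2) : mulOp (c • a) x = c • mulOp a x := by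
  apply Lp.ext
  filter_upwards [coeFn_mulOp (c • a) x, coeFn_mulOp a x,
    Lp.coeFn_smul c (mulOp a x)] with t h1 h2 h4
  rw [h1, h4, Pi.smul_apply, h2]
  simp [mul_assoc]

theorem mulOp_sub (a b : LInf) (x : L2) : mulOp (a - b) x = mulOp a x - mulOp b x := by
  have := mulOp_add (a - b) b x
  rw [sub_add_cancel] at this
  rw [this, add_sub_cancel_right]

theorem mulOp_toL2 (a b : LInf) : mulOp a (toL2 b) = toL2 (a * b) := by
  apply Lp.ext
  filter_upwards [coeFn_mulOp a (toL2 b), coeFn_toL2 b, coeFn_toL2 (a * b)] with t h1 h2 h3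
  rw [h1, h2, h3]
  simp

theorem toL2_star (a : LInf) : toL2 (star a) = star (toL2 a) := by
  apply Lp.ext
  filter_upwards [coeFn_toL2 (star a), coeFn_toL2 a, Lp.coeFn_star (toL2 a)] with t h1 h2 h3
  rw [h1, h3, Pi.star_apply, h2]
  simp

theorem star_mulOp (a : LInf) (x : L2) : star (mulOp a x) = mulOp (star a) (star x) := by
  apply Lp.ext
  filter_upwards [coeFn_mulOp a x, coeFn_mulOp (star a) (star x), Lp.coeFn_star x,
    Lp.coeFn_star (mulOp a x)] with t h1 h2 h3 h4
  rw [h4, Pi.star_apply, h1, h2, h3]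
  simp [mul_comm]

/-- The monomial `z ^ k` as an element of `L^∞`. -/
def zpow (k : ℤ) : LInf :=
  ⟨fun t => fourier k t,
    MemLp.of_bound (fourier k).continuous.aestronglyMeasurable 1 (by
      filter_upwards with t
      exact (Circle.norm_coe _).le)⟩

theorem zbar_eq : zbar = zpow (-1) := rfl

theorem toL2_zpow (k : ℤ) : toL2 (zpow k) = mono k := by
  apply Lp.ext
  filter_upwards [coeFn_toL2 (zpow k), coeFn_fourierLp (T := 1) 2 k] with t h1 h2
  rw [h1, mono, h2]
  rfl

theorem zpow_mul (k l : ℤ) : zpow k * zpow l = zpow (k + l) := by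
  apply Subtype.ext
  funext t
  exact fourier_add.symm

theorem zpow_zero : zpow 0 = 1 := by
  apply Subtype.ext
  funext t
  exact fourier_zero

theorem star_zpow (k : ℤ) : star (zpow k) = zpow (-k) := by
  apply Subtype.ext
  funext t
  exact fourier_neg.symm

theorem toL2_one : toL2 1 = mono 0 := by rw [← zpow_zero, toL2_zpow]

theorem coef_mulOp_zpow (k n : ℤ) (x : L2) : coef n (mulOp (zpow k) x) = coef (n - k) x := by
  rw [coef_eq_fourierCoeff, coef_eq_fourierCoeff]
  apply integral_congr_ae
  filter_upwards [coeFn_mulOp (zpow k) x] with t h1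
  rw [h1, smul_eq_mul, smul_eq_mul, ← mul_assoc]
  congr 1
  change fourier (-n) t * fourier k t = _
  rw [← fourier_add, show -n + k = -(n - k) by ring]

theorem mulOp_zpow_mono (k n : ℤ) : mulOp (zpow k) (mono n) = mono (k + n) := by
  rw [← toL2_zpow, mulOp_toL2, zpow_mul, toL2_zpow]

theorem mulOp_comm (a b : LInf) (x : L2) : mulOp a (mulOp b x) = mulOp b (mulOp a x) := by
  rw [← mulOp_mul, ← mulOp_mul, mul_comm]

theorem coef_star (n : ℤ) (x : L2) : coef n (star x) = star (coef (-n) x) := by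
  rw [coef_eq_fourierCoeff, coef_eq_fourierCoeff, fourierCoeff, fourierCoeff]
  change _ = (starRingEnd ℂ) _
  rw [← integral_conj]
  apply integral_congr_ae
  filter_upwards [Lp.coeFn_star x] with t h1
  rw [h1, Pi.star_apply, smul_eq_mul, smul_eq_mul, map_mul, fourier_neg, fourier_neg, fourier_neg,
    Complex.conj_conj]
  rfl

theorem coef_V (n : ℤ) (x : L2) : coef n (V x) = star (coef (-1 - n) x) := by
  rw [V, zbar_eq, coef_mulOp_zpow, coef_star, show -(n - -1) = -1 - n by ring]

theorem coef_toL2_star (n : ℤ) (a : LInf) : coef n (toL2 (star a)) = star (coef (-n) (toL2 a)) := by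
  rw [toL2_star, coef_star]

theorem V_add (x y : L2) : V (x + y) = V x + V y := by
  apply ext_coef; intro n; simp [coef_V]

theorem V_smul (c : ℂ) (x : L2) : V (c • x) = star c • V x := by
  apply ext_coef; intro n; simp [coef_V]

theorem V_sub (x y : L2) : V (x - y) = V x - V y := by
  apply ext_coef; intro n; simp [coef_V]

theorem V_V (x : L2) : V (V x) = x := by
  apply ext_coef; intro n; rw [coef_V, coef_V, star_star, sub_sub_cancel]

theorem V_eq_zero_iff (x : L2) : V x = 0 ↔ x = 0 := by
  constructor
  · intro h
    rw [← V_V x, h]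
    apply ext_coef; intro n; simp [coef_V]
  · rintro rfl
    apply ext_coef; intro n; simp [coef_V]

theorem V_Pplus (x : L2) : V (Pplus x) = Pminus (V x) := by
  apply ext_coef; intro n; rw [coef_V, coef_Pplus, coef_Pminus, coef_V]
  split_ifs <;> first | omega | simp

theorem V_Pminus (x : L2) : V (Pminus x) = Pplus (V x) := by
  apply ext_coef; intro n; rw [coef_V, coef_Pplus, coef_Pminus, coef_V]
  split_ifs <;> first | omega | simp

theorem V_mulOp (a : LInf) (x : L2) : V (mulOp a x) = mulOp (star a) (V x) := by
  rw [V, V, star_mulOp, mulOp_comm]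

theorem V_mono (n : ℤ) : V (mono n) = mono (-1 - n) := by
  apply ext_coef; intro m; rw [coef_V, coef_mono, coef_mono]
  split_ifs <;> first | omega | simp

theorem coef_mulOp_mono (a : LInf) (m n : ℤ) :
    coef m (mulOp a (mono n)) = coef (m - n) (toL2 a) := by
  rw [← toL2_zpow, mulOp_toL2, mul_comm, ← mulOp_toL2, coef_mulOp_zpow]

/-! ### Multipliers in `H^∞` -/

theorem mem_HInf_iff (a : LInf) : a ∈ HInf ↔ ∀ n : ℤ, n < 0 → coef n (toL2 a) = 0 :=
  mem_H2_iff _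

theorem neg_eq_zero_iff (a : LInf) : neg a = 0 ↔ a ∈ HInf := Pminus_eq_zero_iff _

/-- It suffices to test the bounded operator `P₋ a P₊` on the monomials. -/
theorem mulOp_mem_H2 {a : LInf} (ha : a ∈ HInf) {x : L2} (hx : x ∈ H2) : mulOp a x ∈ H2 := by
  have h : Pminus ∘L mulOp a ∘L Pplus = 0 := by
    apply ext_mono
    intro n
    rcases lt_or_ge n 0 with hn | hn
    · simp [Pplus_mono_neg hn]
    · simp only [ContinuousLinearMap.comp_apply, Pplus_mono hn, zero_apply]
      rw [Pminus_eq_zero_iff, mem_H2_iff]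
      intro m hm
      rw [coef_mulOp_mono]
      exact (mem_HInf_iff a).1 ha _ (by omega)
  have h2 := DFunLike.congr_fun h x
  have h3 : Pplus x = x := by
    have := Pplus_add_Pminus x
    rwa [(Pminus_eq_zero_iff x).2 hx, add_zero] at this
  simp only [ContinuousLinearMap.comp_apply, h3, zero_apply] at h2
  exact (Pminus_eq_zero_iff _).1 h2

/-! ### Matrix entries of products of singular integral operators -/

/-- The entry of index `(m, n)`, with respect to the monomials, of the operator
`H i 0 P₊ H' 0 j + H i 1 P₋ H' 1 j`. For `m` in the half line belonging to `i` (`m ≥ 0` if `i = 0`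
and `m < 0` if `i = 1`) and `n` in the half line belonging to `j`, this is the entry of
`R_H R_H'`; unlike the latter it is defined by one formula for all `m` and `n`. -/
def entry (H H' : Matrix (Fin 2) (Fin 2) LInf) (i j : Fin 2) (m n : ℤ) : ℂ :=
  coef m (mulOp (H i 0) (Pplus (mulOp (H' 0 j) (mono n)))
    + mulOp (H i 1) (Pminus (mulOp (H' 1 j) (mono n))))

/-- The increment of `entry H H' i j` along a diagonal, as a function of frequencies. -/
def increment (H H' : Matrix (Fin 2) (Fin 2) LInf) (i j : Fin 2) (k l : ℤ) : ℂ :=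
  coef k (toL2 (H i 0)) * coef l (toL2 (H' 0 j)) - coef k (toL2 (H i 1)) * coef l (toL2 (H' 1 j))

/-- Multiplication by `z` commutes with `P₊` up to the coefficient that crosses from `z̄` to `1`. -/
theorem Pplus_shift (y : L2) :
    Pplus (mulOp (zpow 1) y) = mulOp (zpow 1) (Pplus y) + coef (-1) y • mono 0 := by
  apply ext_coef
  intro n
  rw [coef_Pplus, map_add, coef_mulOp_zpow, coef_mulOp_zpow, coef_Pplus, map_smul, coef_mono]
  rcases lt_trichotomy n 0 with h | h | h
  · rw [if_neg (by omega), if_neg (by omega), if_neg (by omega)]; simp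
  · subst h; simp
  · rw [if_pos (by omega), if_pos (by omega), if_neg (by omega)]; simp

theorem Pminus_shift (y : L2) :
    Pminus (mulOp (zpow 1) y) = mulOp (zpow 1) (Pminus y) - coef (-1) y • mono 0 := by
  rw [Pminus_apply, Pminus_apply, Pplus_shift, map_sub]
  abel

theorem mono_succ (n : ℤ) : mono (n + 1) = mulOp (zpow 1) (mono n) := by
  rw [mulOp_zpow_mono, add_comm]

/-- Moving `z` through `P₊` and `P₋` produces the opposite rank one terms `z̄ ↦ 1`; this is why only
products of Fourier coefficients appear in the increment. -/
theorem entry_succ (H H' : Matrix (Fin 2) (Fin 2) LInf) (i j : Fin 2) (m n : ℤ) :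
    entry H H' i j (m + 1) (n + 1)
      = entry H H' i j m n + increment H H' i j (m + 1) (-1 - n) := by
  simp only [entry, increment, mono_succ, mulOp_comm _ (zpow 1), Pplus_shift, Pminus_shift,
    map_add, map_sub, map_smul, coef_mulOp_zpow, coef_mulOp_mono, add_sub_cancel_right, smul_eq_mul,
    sub_zero]
  ring

theorem coef_gsio (H : Matrix (Fin 2) (Fin 2) LInf) (m : ℤ) (x : L2) :
    coef m (gsio H x) = if 0 ≤ m then coef m (mulOp (H 0 0) (Pplus x) + mulOp (H 0 1) (Pminus x))
      else coef m (mulOp (H 1 0) (Pplus x) + mulOp (H 1 1) (Pminus x)) := by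
  simp only [gsio, add_apply, ContinuousLinearMap.comp_apply, map_add, coef_Pplus, coef_Pminus]
  split_ifs <;> first | omega | simp

theorem Pplus_gsio (H : Matrix (Fin 2) (Fin 2) LInf) (x : L2) :
    Pplus (gsio H x) = Pplus (mulOp (H 0 0) (Pplus x) + mulOp (H 0 1) (Pminus x)) := by
  apply ext_coef; intro m; rw [coef_Pplus, coef_Pplus, coef_gsio]; split_ifs <;> rfl

theorem Pminus_gsio (H : Matrix (Fin 2) (Fin 2) LInf) (x : L2) :
    Pminus (gsio H x) = Pminus (mulOp (H 1 0) (Pplus x) + mulOp (H 1 1) (Pminus x)) := by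
  apply ext_coef; intro m; rw [coef_Pminus, coef_Pminus, coef_gsio]
  split_ifs <;> first | omega | rfl

theorem coef_gsio_gsio (H H' : Matrix (Fin 2) (Fin 2) LInf) (m n : ℤ) :
    coef m (gsio H (gsio H' (mono n)))
      = entry H H' (if 0 ≤ m then 0 else 1) (if 0 ≤ n then 0 else 1) m n := by
  rw [coef_gsio, Pplus_gsio, Pminus_gsio]
  rcases lt_or_ge n 0 with hn | hn
  · rw [Pplus_mono_neg hn, Pminus_mono_neg hn, if_neg (not_le.2 hn)]
    split_ifs <;> simp [entry]
  · rw [Pplus_mono hn, Pminus_mono hn, if_pos hn]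
    split_ifs <;> simp [entry]

theorem commute_iff_entry (H H' : Matrix (Fin 2) (Fin 2) LInf) :
    gsio H ∘L gsio H' = gsio H' ∘L gsio H ↔
      (∀ m n, 0 ≤ m → 0 ≤ n → entry H H' 0 0 m n = entry H' H 0 0 m n) ∧
      (∀ m n, 0 ≤ m → n < 0 → entry H H' 0 1 m n = entry H' H 0 1 m n) ∧
      (∀ m n, m < 0 → 0 ≤ n → entry H H' 1 0 m n = entry H' H 1 0 m n) ∧
      (∀ m n, m < 0 → n < 0 → entry H H' 1 1 m n = entry H' H 1 1 m n) := by
  constructor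
  · intro h
    have key : ∀ m n, coef m (gsio H (gsio H' (mono n))) = coef m (gsio H' (gsio H (mono n))) :=
      fun m n => congrArg (coef m) (DFunLike.congr_fun h (mono n))
    simp only [coef_gsio_gsio] at key
    refine ⟨fun m n hm hn => ?_, fun m n hm hn => ?_, fun m n hm hn => ?_, fun m n hm hn => ?_⟩ <;>
    · first | rw [← not_le] at hm | skip
      first | rw [← not_le] at hn | skip
      simpa only [hm, hn, if_true, if_false] using key m n
  · rintro ⟨h1, h2, h3, h4⟩
    apply ext_mono
    intro n
    apply ext_coef
    intro m
    simp only [ContinuousLinearMap.comp_apply, coef_gsio_gsio]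
    split_ifs with hm hn hn
    · exact h1 m n hm hn
    · exact h2 m n hm (not_le.1 hn)
    · exact h3 m n (not_le.1 hm) hn
    · exact h4 m n (not_le.1 hm) (not_le.1 hn)

/-! ### Propagation along diagonals -/

/-- Along diagonals running to `(∞, ∞)`, decay takes the place of boundary values: vanishing
increments make the values constant, hence equal to their limit. -/
theorem diag_pos {t w : ℤ → ℤ → ℂ} (h : ∀ m n, t (m + 1) (n + 1) = t m n + w (m + 1) (-1 - n))
    (h0 : ∀ m n, Filter.Tendsto (fun k : ℕ => t (m + k) (n + k)) Filter.atTop (nhds 0)) :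
    (∀ m n, 0 ≤ m → 0 ≤ n → t m n = 0) ↔ ∀ k l, 0 < k → l < 0 → w k l = 0 := by
  constructor
  · intro ht k l hk hl
    have := h (k - 1) (-1 - l)
    rw [ht _ _ (by omega) (by omega), ht _ _ (by omega) (by omega)] at this
    simpa using this.symm
  · intro hw m n hm hn
    have hc : ∀ k : ℕ, t (m + k) (n + k) = t m n := by
      intro k
      induction k with
      | zero => simp
      | succ k ih =>
        rw [← ih]
        push_cast
        rw [← add_assoc, ← add_assoc, h, hw _ _ (by omega) (by omega), add_zero]
    exact tendsto_nhds_unique (tendsto_const_nhds) ((h0 m n).congr hc)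

/-- The analogue of `diag_pos` along the diagonals running to `(-∞, -∞)`. -/
theorem diag_neg {t w : ℤ → ℤ → ℂ} (h : ∀ m n, t (m + 1) (n + 1) = t m n + w (m + 1) (-1 - n))
    (h0 : ∀ m n, Filter.Tendsto (fun k : ℕ => t (m - k) (n - k)) Filter.atTop (nhds 0)) :
    (∀ m n, m < 0 → n < 0 → t m n = 0) ↔ ∀ k l, k < 0 → 0 < l → w k l = 0 := by
  constructor
  · intro ht k l hk hl
    have := h (k - 1) (-1 - l)
    rw [ht _ _ (by omega) (by omega), ht _ _ (by omega) (by omega)] at this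
    simpa using this.symm
  · intro hw m n hm hn
    have hc : ∀ k : ℕ, t (m - k) (n - k) = t m n := by
      intro k
      induction k with
      | zero => simp
      | succ k ih =>
        rw [← ih]
        have := h (m - (k + 1 : ℕ)) (n - (k + 1 : ℕ))
        rw [hw _ _ (by push_cast; omega) (by push_cast; omega), add_zero] at this
        rw [← this]
        push_cast
        congr 1 <;> ring
    exact tendsto_nhds_unique (tendsto_const_nhds) ((h0 m n).congr hc)

/-- The analogue of `diag_pos_neg` for the opposite quadrant, where every diagonal starts at `n = 0`. -/
theorem diag_neg_pos {t w : ℤ → ℤ → ℂ}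
    (h : ∀ m n, t (m + 1) (n + 1) = t m n + w (m + 1) (-1 - n)) :
    (∀ m n, m < 0 → 0 ≤ n → t m n = 0)
      ↔ (∀ k l, k < 0 → l < 0 → w k l = 0) ∧ ∀ m, m < 0 → t m 0 = 0 := by
  constructor
  · intro ht
    refine ⟨fun k l hk hl => ?_, fun m hm => ht m 0 hm le_rfl⟩
    have := h (k - 1) (-1 - l)
    rw [ht _ _ (by omega) (by omega), ht _ _ (by omega) (by omega)] at this
    simpa using this.symm
  · rintro ⟨hw, hb⟩ m n hm hn
    lift n to ℕ using hn
    induction n generalizing m with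
    | zero => exact hb m hm
    | succ n ih =>
      have := h (m - 1) n
      rw [ih _ (by omega), hw _ _ (by omega) (by omega), add_zero, sub_add_cancel] at this
      exact_mod_cast this

/-- In the quadrant `m ≥ 0 > n` every diagonal ends at `n = -1`, so the values there and the
increments determine everything. -/
theorem diag_pos_neg {t w : ℤ → ℤ → ℂ}
    (h : ∀ m n, t (m + 1) (n + 1) = t m n + w (m + 1) (-1 - n)) :
    (∀ m n, 0 ≤ m → n < 0 → t m n = 0)
      ↔ (∀ k l, 0 < k → 0 < l → w k l = 0) ∧ ∀ m, 0 ≤ m → t m (-1) = 0 := by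
  constructor
  · intro ht
    refine ⟨fun k l hk hl => ?_, fun m hm => ht m (-1) hm (by norm_num)⟩
    have := h (k - 1) (-1 - l)
    rw [ht _ _ (by omega) (by omega), ht _ _ (by omega) (by omega)] at this
    simpa using this.symm
  · rintro ⟨hw, hb⟩ m n hm hn
    obtain ⟨p, rfl⟩ : ∃ p : ℕ, n = -1 - p := ⟨(-1 - n).toNat, by omega⟩
    induction p generalizing m with
    | zero => simpa using hb m hm
    | succ p ih =>
      have := h m (-1 - (p + 1 : ℕ))
      rw [hw _ _ (by omega) (by omega), add_zero] at this
      rw [← this]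
      have e : (-1 - ((p + 1 : ℕ) : ℤ) + 1) = -1 - p := by push_cast; ring
      rw [e]
      exact ih _ (by omega) (by omega)

/-! ### Decay of Hankel operators along the shift -/

theorem norm_sq_eq_tsum (x : L2) : ‖x‖ ^ 2 = ∑' n, ‖coef n x‖ ^ 2 := by
  have H₁ : HasSum (fun i => ‖fourierBasis.repr x i‖ ^ 2) (‖fourierBasis.repr x‖ ^ 2) := by
    apply_mod_cast lp.hasSum_norm ?_ (fourierBasis.repr x)
    simp
  rw [LinearIsometryEquiv.norm_map] at H₁
  simp only [coef_eq_repr]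
  exact H₁.tsum_eq.symm

theorem summable_norm_sq_coef (x : L2) : Summable fun n => ‖coef n x‖ ^ 2 := by
  have H₁ : HasSum (fun i => ‖fourierBasis.repr x i‖ ^ 2) (‖fourierBasis.repr x‖ ^ 2) := by
    apply_mod_cast lp.hasSum_norm ?_ (fourierBasis.repr x)
    simp
  simp only [coef_eq_repr]
  exact H₁.summable

/-- By Parseval, `‖P₋ z ^ k x‖ ^ 2` is a tail of the convergent series of squared coefficients. -/
theorem tendsto_Pminus_shift (x : L2) :
    Filter.Tendsto (fun k : ℕ => Pminus (mulOp (zpow k) x)) Filter.atTop (nhds 0) := by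
  rw [tendsto_zero_iff_norm_tendsto_zero]
  have hsq : Filter.Tendsto (fun k : ℕ => ‖Pminus (mulOp (zpow k) x)‖ ^ 2)
      Filter.atTop (nhds 0) := by
    have hs : ∀ k : ℕ, ‖Pminus (mulOp (zpow k) x)‖ ^ 2
        = ∑' n : ℤ, if n + k < 0 then ‖coef n x‖ ^ 2 else 0 := by
      intro k
      rw [norm_sq_eq_tsum, ← (Equiv.addRight (k : ℤ)).tsum_eq]
      refine tsum_congr fun n => ?_
      simp only [Equiv.coe_addRight, coef_Pminus, coef_mulOp_zpow, add_sub_cancel_right]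
      split_ifs <;> simp
    simp only [hs]
    have := tendsto_tsum_of_dominated_convergence (𝓕 := Filter.atTop)
      (f := fun (k : ℕ) (n : ℤ) => if n + k < 0 then ‖coef n x‖ ^ 2 else 0) (g := fun _ => (0 : ℝ))
      (summable_norm_sq_coef x) (fun n => ?_) (Filter.Eventually.of_forall fun k n => ?_)
    · simpa using this
    · refine tendsto_const_nhds.congr' ?_
      filter_upwards [Filter.eventually_ge_atTop n.natAbs] with k hk
      rw [if_neg (by omega)]
    · split_ifs <;> simp
  have := hsq.sqrt
  simpa [Real.sqrt_sq (norm_nonneg _)] using this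

theorem norm_V (x : L2) : ‖V x‖ = ‖x‖ := by
  have h : ‖V x‖ ^ 2 = ‖x‖ ^ 2 := by
    rw [norm_sq_eq_tsum, norm_sq_eq_tsum, ← (Equiv.subLeft (-1 : ℤ)).tsum_eq]
    refine tsum_congr fun n => ?_
    simp [coef_V]
  exact (sq_eq_sq₀ (norm_nonneg _) (norm_nonneg _)).1 h

theorem tendsto_Pplus_shift (x : L2) :
    Filter.Tendsto (fun k : ℕ => Pplus (mulOp (zpow (-k)) x)) Filter.atTop (nhds 0) := by
  have h := tendsto_Pminus_shift (V x)
  rw [tendsto_zero_iff_norm_tendsto_zero] at h ⊢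
  refine h.congr fun k => ?_
  rw [← norm_V (Pplus _), V_Pplus, V_mulOp, star_zpow, neg_neg]

theorem norm_mono (n : ℤ) : ‖mono n‖ = 1 := orthonormal_fourier.1 n

theorem norm_coef_le (n : ℤ) (x : L2) : ‖coef n x‖ ≤ ‖x‖ := by
  have := norm_inner_le_norm (𝕜 := ℂ) (mono n) x
  rwa [norm_mono, one_mul] at this

theorem tendsto_coef_zero {y : ℕ → L2} (hy : Filter.Tendsto y Filter.atTop (nhds 0)) (a : LInf)
    (m : ℕ → ℤ) : Filter.Tendsto (fun k => coef (m k) (mulOp a (y k))) Filter.atTop (nhds 0) := by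
  have h : Filter.Tendsto (fun k => mulOp a (y k)) Filter.atTop (nhds 0) := by
    simpa [Function.comp_def] using ((mulOp a).continuous.tendsto 0).comp hy
  exact squeeze_zero_norm (fun k => norm_coef_le _ _) (by simpa using h.norm)

theorem tendsto_hankel_pos (a b : LInf) (m n : ℤ) :
    Filter.Tendsto (fun k : ℕ => coef (m + k) (mulOp a (Pminus (mulOp b (mono (n + k))))))
      Filter.atTop (nhds 0) := by
  have := tendsto_coef_zero (tendsto_Pminus_shift (mulOp b (mono n))) a (fun k => m + k)
  refine this.congr fun k => ?_
  rw [mulOp_comm (zpow k), mulOp_zpow_mono, add_comm n]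

theorem tendsto_hankel_neg (a b : LInf) (m n : ℤ) :
    Filter.Tendsto (fun k : ℕ => coef (m - k) (mulOp a (Pplus (mulOp b (mono (n - k))))))
      Filter.atTop (nhds 0) := by
  have := tendsto_coef_zero (tendsto_Pplus_shift (mulOp b (mono n))) a (fun k => m - k)
  refine this.congr fun k => ?_
  rw [mulOp_comm (zpow (-k)), mulOp_zpow_mono, neg_add_eq_sub]

/-- The Toeplitz parts `f f'` of the two products cancel, since multiplications commute; what
remains is a sum of products of Hankel operators. -/
theorem tendsto_entry_pos (H H' : Matrix (Fin 2) (Fin 2) LInf) (m n : ℤ) :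
    Filter.Tendsto (fun k : ℕ => entry H H' 0 0 (m + k) (n + k) - entry H' H 0 0 (m + k) (n + k))
      Filter.atTop (nhds 0) := by
  have h := ((tendsto_hankel_pos (H 0 1) (H' 1 0) m n).sub
    (tendsto_hankel_pos (H 0 0) (H' 0 0) m n)).sub ((tendsto_hankel_pos (H' 0 1) (H 1 0) m n).sub
    (tendsto_hankel_pos (H' 0 0) (H 0 0) m n))
  simp only [sub_zero] at h
  refine h.congr fun k => ?_
  have e : ∀ x, Pplus x = x - Pminus x := fun x =>
    eq_sub_of_add_eq (Pplus_add_Pminus x)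
  simp only [entry, e, map_add, map_sub]
  rw [mulOp_comm (H 0 0) (H' 0 0)]
  ring

/-- As in `tendsto_entry_pos`, the parts `v v'` cancel. -/
theorem tendsto_entry_neg (H H' : Matrix (Fin 2) (Fin 2) LInf) (m n : ℤ) :
    Filter.Tendsto (fun k : ℕ => entry H H' 1 1 (m - k) (n - k) - entry H' H 1 1 (m - k) (n - k))
      Filter.atTop (nhds 0) := by
  have h := ((tendsto_hankel_neg (H 1 0) (H' 0 1) m n).sub
    (tendsto_hankel_neg (H 1 1) (H' 1 1) m n)).sub ((tendsto_hankel_neg (H' 1 0) (H 0 1) m n).sub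
    (tendsto_hankel_neg (H' 1 1) (H 1 1) m n))
  simp only [sub_zero] at h
  refine h.congr fun k => ?_
  simp only [entry, Pminus_apply, map_add, map_sub]
  rw [mulOp_comm (H 1 1) (H' 1 1)]
  ring

/-! ### The tensor equation in terms of Fourier coefficients -/

/-- The column `(V(f̄)₋, g₋)`, which depends linearly on `(f, g)`. -/
def colVec (f g : LInf) : L2Col := col (V (neg (star f))) (neg g)

/-- The column `(Vf₋, (ū)₋)`, which depends antilinearly on `(f, u)`. -/
def rowVec (f u : LInf) : L2Col := col (V (neg f)) (neg (star u))

theorem colVec_fst (f g : LInf) : (colVec f g).fst = V (neg (star f)) := rfl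

theorem colVec_snd (f g : LInf) : (colVec f g).snd = neg g := rfl

theorem W_eq (H H' : Matrix (Fin 2) (Fin 2) LInf) :
    W H H' = tensor (colVec (H 0 0) (H 1 0)) (rowVec (H' 0 0) (H' 0 1))
      - tensor (colVec (H 0 1) (H 1 1)) (rowVec (H' 1 0) (H' 1 1)) := rfl

theorem coef_neg (n : ℤ) (f : LInf) : coef n (neg f) = if n < 0 then coef n (toL2 f) else 0 :=
  coef_Pminus _ _

theorem coef_V_neg (n : ℤ) (f : LInf) :
    coef n (V (neg f)) = if 0 ≤ n then star (coef (-1 - n) (toL2 f)) else 0 := by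
  rw [coef_V, coef_neg]
  split_ifs <;> first | omega | simp

theorem coef_V_neg_star (n : ℤ) (f : LInf) :
    coef n (V (neg (star f))) = if 0 ≤ n then coef (n + 1) (toL2 f) else 0 := by
  rw [coef_V_neg]
  split_ifs
  · rw [coef_toL2_star, star_star, show -(-1 - n) = n + 1 by ring]
  · rfl

theorem coef_neg_star (n : ℤ) (f : LInf) :
    coef n (neg (star f)) = if n < 0 then star (coef (-n) (toL2 f)) else 0 := by
  rw [coef_neg, coef_toL2_star]

theorem inner_mono (x : L2) (n : ℤ) : inner ℂ x (mono n) = star (coef n x) :=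
  (inner_conj_symm x (mono n)).symm

theorem inner_rowVec_fst (f u : LInf) (n : ℤ) :
    inner ℂ (rowVec f u) (col (mono n) 0) = if 0 ≤ n then coef (-1 - n) (toL2 f) else 0 := by
  rw [WithLp.prod_inner_apply]
  simp only [rowVec, col, inner_mono, inner_zero_right, add_zero, coef_V_neg]
  split_ifs <;> simp

theorem inner_rowVec_snd (f u : LInf) (n : ℤ) :
    inner ℂ (rowVec f u) (col 0 (mono n)) = if n < 0 then coef (-n) (toL2 u) else 0 := by
  rw [WithLp.prod_inner_apply]
  simp only [rowVec, col, inner_mono, inner_zero_right, zero_add, coef_neg_star]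
  split_ifs <;> simp

theorem W_apply (H H' : Matrix (Fin 2) (Fin 2) LInf) (x : L2Col) :
    W H H' x = inner ℂ (rowVec (H' 0 0) (H' 0 1)) x • colVec (H 0 0) (H 1 0)
      - inner ℂ (rowVec (H' 1 0) (H' 1 1)) x • colVec (H 0 1) (H 1 1) := by
  rw [W_eq, sub_apply, tensor_apply, tensor_apply]

theorem coef_W_fst_fst (H H' : Matrix (Fin 2) (Fin 2) LInf) (m n : ℤ) :
    coef m (W H H' (col (mono n) 0)).fst
      = if 0 ≤ m ∧ 0 ≤ n then increment H H' 0 0 (m + 1) (-1 - n) else 0 := by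
  rw [W_apply, inner_rowVec_fst, inner_rowVec_fst]
  simp only [WithLp.sub_fst, WithLp.smul_fst, colVec_fst, map_sub, map_smul, coef_V_neg_star,
    increment, smul_eq_mul]
  split_ifs <;> first | omega | simp [mul_comm]

theorem coef_W_fst_snd (H H' : Matrix (Fin 2) (Fin 2) LInf) (m n : ℤ) :
    coef m (W H H' (col (mono n) 0)).snd
      = if m < 0 ∧ 0 ≤ n then increment H H' 1 0 m (-1 - n) else 0 := by
  rw [W_apply, inner_rowVec_fst, inner_rowVec_fst]
  simp only [WithLp.sub_snd, WithLp.smul_snd, colVec_snd, map_sub, map_smul, coef_neg,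
    increment, smul_eq_mul]
  split_ifs <;> first | omega | simp [mul_comm]

theorem coef_W_snd_fst (H H' : Matrix (Fin 2) (Fin 2) LInf) (m n : ℤ) :
    coef m (W H H' (col 0 (mono n))).fst
      = if 0 ≤ m ∧ n < 0 then increment H H' 0 1 (m + 1) (-n) else 0 := by
  rw [W_apply, inner_rowVec_snd, inner_rowVec_snd]
  simp only [WithLp.sub_fst, WithLp.smul_fst, colVec_fst, map_sub, map_smul, coef_V_neg_star,
    increment, smul_eq_mul]
  split_ifs <;> first | omega | simp [mul_comm]

theorem coef_W_snd_snd (H H' : Matrix (Fin 2) (Fin 2) LInf) (m n : ℤ) :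
    coef m (W H H' (col 0 (mono n))).snd
      = if m < 0 ∧ n < 0 then increment H H' 1 1 m (-n) else 0 := by
  rw [W_apply, inner_rowVec_snd, inner_rowVec_snd]
  simp only [WithLp.sub_snd, WithLp.smul_snd, colVec_snd, map_sub, map_smul, coef_neg,
    increment, smul_eq_mul]
  split_ifs <;> first | omega | simp [mul_comm]

theorem ext_col {S T : L2Col →L[ℂ] L2Col} (h1 : ∀ n, S (col (mono n) 0) = T (col (mono n) 0))
    (h2 : ∀ n, S (col 0 (mono n)) = T (col 0 (mono n))) : S = T := by
  have e1 : S ∘L (WithLp.prodContinuousLinearEquiv 2 ℂ L2 L2).symm.toContinuousLinearMap ∘L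
        ContinuousLinearMap.inl ℂ L2 L2
      = T ∘L (WithLp.prodContinuousLinearEquiv 2 ℂ L2 L2).symm.toContinuousLinearMap ∘L
        ContinuousLinearMap.inl ℂ L2 L2 := ext_mono h1
  have e2 : S ∘L (WithLp.prodContinuousLinearEquiv 2 ℂ L2 L2).symm.toContinuousLinearMap ∘L
        ContinuousLinearMap.inr ℂ L2 L2
      = T ∘L (WithLp.prodContinuousLinearEquiv 2 ℂ L2 L2).symm.toContinuousLinearMap ∘L
        ContinuousLinearMap.inr ℂ L2 L2 := ext_mono h2
  ext1 x
  have hx : x = col x.fst 0 + col 0 x.snd := by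
    refine WithLp.ofLp_injective 2 (Prod.ext ?_ ?_)
    · exact (add_zero x.fst).symm
    · exact (zero_add x.snd).symm
  rw [hx, map_add, map_add]
  exact congrArg₂ _ (DFunLike.congr_fun e1 x.fst) (DFunLike.congr_fun e2 x.snd)

theorem col_ext {x y : L2Col} (h1 : x.fst = y.fst) (h2 : x.snd = y.snd) : x = y :=
  WithLp.ofLp_injective 2 (Prod.ext h1 h2)

/-- The tensor equation says that the increments of `R_H R_H'` and `R_H' R_H` agree at all
frequencies seen by `V(f̄)₋, g₋, …`. -/
theorem W_eq_W_iff (H H' : Matrix (Fin 2) (Fin 2) LInf) :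
    W H H' = W H' H ↔
      (∀ k l, 0 < k → l < 0 → increment H H' 0 0 k l = increment H' H 0 0 k l) ∧
      (∀ k l, 0 < k → 0 < l → increment H H' 0 1 k l = increment H' H 0 1 k l) ∧
      (∀ k l, k < 0 → l < 0 → increment H H' 1 0 k l = increment H' H 1 0 k l) ∧
      (∀ k l, k < 0 → 0 < l → increment H H' 1 1 k l = increment H' H 1 1 k l) := by
  constructor
  · intro h
    refine ⟨fun k l hk hl => ?_, fun k l hk hl => ?_, fun k l hk hl => ?_, fun k l hk hl => ?_⟩
    · have := coef_W_fst_fst H H' (k - 1) (-1 - l)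
      rw [h, coef_W_fst_fst, if_pos (by omega), if_pos (by omega)] at this
      simpa using this.symm
    · have := coef_W_snd_fst H H' (k - 1) (-l)
      rw [h, coef_W_snd_fst, if_pos (by omega), if_pos (by omega)] at this
      simpa using this.symm
    · have := coef_W_fst_snd H H' k (-1 - l)
      rw [h, coef_W_fst_snd, if_pos (by omega), if_pos (by omega)] at this
      simpa using this.symm
    · have := coef_W_snd_snd H H' k (-l)
      rw [h, coef_W_snd_snd, if_pos (by omega), if_pos (by omega)] at this
      simpa using this.symm
  · rintro ⟨h1, h2, h3, h4⟩
    apply ext_col <;> intro n <;> apply col_ext <;> apply ext_coef <;> intro m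
    · rw [coef_W_fst_fst, coef_W_fst_fst]
      split_ifs
      · exact h1 _ _ (by omega) (by omega)
      · rfl
    · rw [coef_W_fst_snd, coef_W_fst_snd]
      split_ifs
      · exact h3 _ _ (by omega) (by omega)
      · rfl
    · rw [coef_W_snd_fst, coef_W_snd_fst]
      split_ifs
      · exact h2 _ _ (by omega) (by omega)
      · rfl
    · rw [coef_W_snd_snd, coef_W_snd_snd]
      split_ifs
      · exact h4 _ _ (by omega) (by omega)
      · rfl

/-! ### The commutation criterion -/

/-- `P₋ R_H R_H' 1 = P₋(g P₊ f' + v P₋ g')`. -/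
def lowerCorner (H H' : Matrix (Fin 2) (Fin 2) LInf) : L2 :=
  Pminus (mulOp (H 1 0) (Pplus (toL2 (H' 0 0))) + mulOp (H 1 1) (Pminus (toL2 (H' 1 0))))

/-- `P₋(ū P₊ v̄' + f̄ P₋ ū')`, the image under `V` of `P₊ R_H R_H' z̄`. -/
def upperCorner (H H' : Matrix (Fin 2) (Fin 2) LInf) : L2 :=
  Pminus (mulOp (star (H 0 1)) (Pplus (toL2 (star (H' 1 1))))
    + mulOp (star (H 0 0)) (Pminus (toL2 (star (H' 0 1)))))

theorem mulOp_mono_zero (a : LInf) : mulOp a (mono 0) = toL2 a := by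
  rw [← toL2_one, mulOp_toL2, mul_one]

theorem coef_lowerCorner (H H' : Matrix (Fin 2) (Fin 2) LInf) (m : ℤ) :
    coef m (lowerCorner H H') = if m < 0 then entry H H' 1 0 m 0 else 0 := by
  rw [lowerCorner, coef_Pminus, entry, mulOp_mono_zero, mulOp_mono_zero]

theorem upperCorner_eq (H H' : Matrix (Fin 2) (Fin 2) LInf) :
    upperCorner H H' = Pminus (V (mulOp (H 0 0) (Pplus (mulOp (H' 0 1) (mono (-1))))
      + mulOp (H 0 1) (Pminus (mulOp (H' 1 1) (mono (-1)))))) := by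
  rw [V_add, V_mulOp, V_mulOp, V_Pplus, V_Pminus, V_mulOp, V_mulOp, V_mono, sub_self,
    mulOp_mono_zero, mulOp_mono_zero, add_comm]
  rfl

theorem coef_upperCorner (H H' : Matrix (Fin 2) (Fin 2) LInf) (m : ℤ) :
    coef m (upperCorner H H')
      = if m < 0 then star (entry H H' 0 1 (-1 - m) (-1)) else 0 := by
  rw [upperCorner_eq, coef_Pminus, coef_V]
  rfl

theorem lowerCorner_eq_iff (H H' : Matrix (Fin 2) (Fin 2) LInf) :
    lowerCorner H H' = lowerCorner H' H
      ↔ ∀ m, m < 0 → entry H H' 1 0 m 0 = entry H' H 1 0 m 0 := by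
  constructor
  · intro h m hm
    have := congrArg (coef m) h
    rwa [coef_lowerCorner, coef_lowerCorner, if_pos hm, if_pos hm] at this
  · intro h
    apply ext_coef
    intro m
    rw [coef_lowerCorner, coef_lowerCorner]
    split_ifs with hm
    · exact h m hm
    · rfl

theorem upperCorner_eq_iff (H H' : Matrix (Fin 2) (Fin 2) LInf) :
    upperCorner H H' = upperCorner H' H
      ↔ ∀ m, 0 ≤ m → entry H H' 0 1 m (-1) = entry H' H 0 1 m (-1) := by
  constructor
  · intro h m hm
    have := congrArg (coef (-1 - m)) h
    rw [coef_upperCorner, coef_upperCorner, if_pos (by omega), if_pos (by omega),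
      sub_sub_cancel] at this
    exact star_injective this
  · intro h
    apply ext_coef
    intro m
    rw [coef_upperCorner, coef_upperCorner]
    split_ifs with hm
    · rw [h _ (by omega)]
    · rfl

/-- Two singular integral operators commute if and only if the tensor equation holds and the
products `R_H R_H'` and `R_H' R_H` agree at `1` (modulo `H²`) and at `z̄` (modulo the orthogonal
complement of `H²`). -/
theorem commute_iff (H H' : Matrix (Fin 2) (Fin 2) LInf) :
    gsio H ∘L gsio H' = gsio H' ∘L gsio H ↔
      W H H' = W H' H ∧ lowerCorner H H' = lowerCorner H' H ∧
        upperCorner H H' = upperCorner H' H := by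
  have hs : ∀ i j m n, entry H H' i j (m + 1) (n + 1) - entry H' H i j (m + 1) (n + 1)
      = entry H H' i j m n - entry H' H i j m n
        + (increment H H' i j (m + 1) (-1 - n) - increment H' H i j (m + 1) (-1 - n)) := by
    intro i j m n
    rw [entry_succ, entry_succ]
    ring
  have h1 := diag_pos (t := fun m n => entry H H' 0 0 m n - entry H' H 0 0 m n)
    (w := fun k l => increment H H' 0 0 k l - increment H' H 0 0 k l)
    (hs 0 0) (tendsto_entry_pos H H')
  have h2 := diag_pos_neg (t := fun m n => entry H H' 0 1 m n - entry H' H 0 1 m n)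
    (w := fun k l => increment H H' 0 1 k l - increment H' H 0 1 k l) (hs 0 1)
  have h3 := diag_neg_pos (t := fun m n => entry H H' 1 0 m n - entry H' H 1 0 m n)
    (w := fun k l => increment H H' 1 0 k l - increment H' H 1 0 k l) (hs 1 0)
  have h4 := diag_neg (t := fun m n => entry H H' 1 1 m n - entry H' H 1 1 m n)
    (w := fun k l => increment H H' 1 1 k l - increment H' H 1 1 k l)
    (hs 1 1) (tendsto_entry_neg H H')
  simp only [sub_eq_zero] at h1 h2 h3 h4
  rw [commute_iff_entry, W_eq_W_iff, lowerCorner_eq_iff, upperCorner_eq_iff, h1, h2, h3, h4]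
  tauto

/-! ### Tensors of rank one -/

section RankOne

variable {E : Type*} [NormedAddCommGroup E] [InnerProductSpace ℂ E]

theorem exists_inner_ne_zero_of_not_dependent {p q : E} (h : ∀ l : ℂ, q ≠ l • p) :
    ∃ x : E, inner ℂ p x = 0 ∧ inner ℂ q x ≠ 0 := by
  refine ⟨q - (inner ℂ p q / inner ℂ p p) • p, ?_, fun h0 => h (inner ℂ p q / inner ℂ p p) ?_⟩
  all_goals
    have hx : inner ℂ p (q - (inner ℂ p q / inner ℂ p p) • p) = 0 := by
      rcases eq_or_ne p 0 with rfl | hp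
      · simp
      · rw [inner_sub_right, inner_smul_right, div_mul_cancel₀ _ (inner_self_ne_zero.2 hp),
          sub_self]
  · exact hx
  · rw [← sub_eq_zero, ← inner_self_eq_zero (𝕜 := ℂ), inner_sub_left, inner_smul_left, hx, h0]
    simp

/-- If `p₁ ⊗ q₁ - p₂ ⊗ q₂` has rank one, then `p₁, p₂` are proportional, or `q₁, q₂` are. -/
theorem dependent_of_finrank_range_eq_one {p₁ p₂ q₁ q₂ : E} {T : E →ₗ[ℂ] E}
    (hT : ∀ x, T x = inner ℂ q₁ x • p₁ - inner ℂ q₂ x • p₂)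
    (h : Module.finrank ℂ (LinearMap.range T) = 1) :
    (∃ l : ℂ, p₁ = l • p₂) ∨ (∃ l : ℂ, p₂ = l • p₁) ∨ (∃ l : ℂ, q₁ = l • q₂) ∨
      ∃ l : ℂ, q₂ = l • q₁ := by
  by_contra! hc
  obtain ⟨h1, h2, h3, h4⟩ := hc
  have hp₁ : p₁ ∈ LinearMap.range T := by
    obtain ⟨x, hx, hx'⟩ := exists_inner_ne_zero_of_not_dependent h3
    refine ⟨(inner ℂ q₁ x)⁻¹ • x, ?_⟩
    rw [map_smul, hT, hx, zero_smul, sub_zero, smul_smul, inv_mul_cancel₀ hx', one_smul]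
  have hp₂ : p₂ ∈ LinearMap.range T := by
    obtain ⟨x, hx, hx'⟩ := exists_inner_ne_zero_of_not_dependent h4
    refine ⟨-(inner ℂ q₂ x)⁻¹ • x, ?_⟩
    rw [map_smul, hT, hx, zero_smul, zero_sub, smul_neg, neg_smul, neg_neg, smul_smul,
      inv_mul_cancel₀ hx', one_smul]
  obtain ⟨v, -, hv⟩ := finrank_eq_one_iff'.1 h
  obtain ⟨c, hc⟩ := hv ⟨p₁, hp₁⟩
  obtain ⟨d, hd⟩ := hv ⟨p₂, hp₂⟩
  have hc' : c • (v : E) = p₁ := congrArg Subtype.val hc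
  have hd' : d • (v : E) = p₂ := congrArg Subtype.val hd
  rcases eq_or_ne d 0 with rfl | hd0
  · rw [zero_smul] at hd'
    exact h2 0 (by rw [zero_smul, hd'])
  · exact h1 (c / d) (by rw [← hd', smul_smul, div_mul_cancel₀ _ hd0, hc'])

end RankOne

/-- Two equal nonzero elementary tensors have proportional factors. -/
theorem exists_smul_of_tensor_eq {p q p' q' : L2Col} (h : tensor p q = tensor p' q')
    (h0 : tensor p q ≠ 0) : ∃ α : ℂ, α ≠ 0 ∧ p = α • p' ∧ q' = star α • q := by
  have hp : p ≠ 0 := by rintro rfl; exact h0 (by simp [tensor])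
  have hq : q ≠ 0 := by rintro rfl; exact h0 (by simp [tensor])
  have hqq : (inner ℂ q q : ℂ) ≠ 0 := inner_self_ne_zero.2 hq
  have hx : ∀ x, inner ℂ q x • p = inner ℂ q' x • p' := fun x => by
    rw [← tensor_apply, ← tensor_apply, h]
  have hpα : p = (inner ℂ q' q / inner ℂ q q : ℂ) • p' := by
    rw [div_eq_inv_mul, mul_smul, ← hx q, smul_smul, inv_mul_cancel₀ hqq, one_smul]
  refine ⟨inner ℂ q' q / inner ℂ q q, fun h1 => hp (by rw [hpα, h1, zero_smul]), hpα, ?_⟩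
  set α : ℂ := inner ℂ q' q / inner ℂ q q
  have hp' : p' ≠ 0 := by rintro rfl; exact hp (by rw [hpα, smul_zero])
  refine ext_inner_right ℂ fun x => ?_
  have h2 := hx x
  rw [hpα, smul_smul] at h2
  rw [inner_smul_left, ← smul_left_injective ℂ hp' h2]
  simp [mul_comm]

/-! ### Hankel forms -/

theorem neg_map_sub (a b : LInf) : neg (a - b) = neg a - neg b := by
  simp only [neg, map_sub]

theorem neg_map_add (a b : LInf) : neg (a + b) = neg a + neg b := by
  simp only [neg, map_add]

theorem neg_map_smul (c : ℂ) (a : LInf) : neg (c • a) = c • neg a := by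
  simp only [neg, map_smul]

/-- The Hankel form `P₋(a P₋ b)`. -/
def hankel (a b : LInf) : L2 := Pminus (mulOp a (neg b))

theorem hankel_sub_left (a a' b : LInf) : hankel (a - a') b = hankel a b - hankel a' b := by
  simp only [hankel, mulOp_sub, map_sub]

theorem hankel_smul_left (c : ℂ) (a b : LInf) : hankel (c • a) b = c • hankel a b := by
  simp only [hankel, mulOp_smul, map_smul]

theorem hankel_sub_right (a b b' : LInf) : hankel a (b - b') = hankel a b - hankel a b' := by
  simp only [hankel, neg_map_sub, map_sub]

theorem hankel_smul_right (c : ℂ) (a b : LInf) : hankel a (c • b) = c • hankel a b := by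
  simp only [hankel, neg_map_smul, map_smul]

theorem Pminus_mulOp_Pplus (a b : LInf) :
    Pminus (mulOp a (Pplus (toL2 b))) = neg (a * b) - hankel a b := by
  rw [neg, ← mulOp_toL2, hankel, ← map_sub, neg, ← map_sub, Pminus_apply (toL2 b), sub_sub_cancel]

theorem hankel_of_mem_left {a : LInf} (ha : a ∈ HInf) (b : LInf) : hankel a b = neg (a * b) := by
  have h := Pminus_mulOp_Pplus a b
  have h0 : Pminus (mulOp a (Pplus (toL2 b))) = 0 :=
    (Pminus_eq_zero_iff _).2 (mulOp_mem_H2 ha (H2.starProjection_apply_mem _))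
  rw [h0] at h
  exact (sub_eq_zero.1 h.symm).symm

theorem hankel_of_mem_right (a : LInf) {b : LInf} (hb : b ∈ HInf) : hankel a b = 0 := by
  rw [hankel, (neg_eq_zero_iff b).2 hb, map_zero, map_zero]

/-- A linear relation modulo `H^∞` in the left argument of a Hankel form. -/
theorem hankel_left_of_sub_mem {a a' : LInf} {c : ℂ} (h : a - c • a' ∈ HInf) (b : LInf) :
    hankel a b = c • hankel a' b + neg ((a - c • a') * b) := by
  rw [← hankel_of_mem_left h, hankel_sub_left, hankel_smul_left, add_sub_cancel]

theorem hankel_right_of_sub_mem (a : LInf) {b b' : LInf} {c : ℂ} (h : b - c • b' ∈ HInf) :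
    hankel a b = c • hankel a b' := by
  have := hankel_of_mem_right a h
  rwa [hankel_sub_right, hankel_smul_right, sub_eq_zero] at this

theorem lowerCorner_eq (H H' : Matrix (Fin 2) (Fin 2) LInf) :
    lowerCorner H H'
      = neg (H 1 0 * H' 0 0) - hankel (H 1 0) (H' 0 0) + hankel (H 1 1) (H' 1 0) := by
  rw [lowerCorner, map_add, Pminus_mulOp_Pplus]
  rfl

theorem upperCorner_eq_hankel (H H' : Matrix (Fin 2) (Fin 2) LInf) :
    upperCorner H H' = neg (star (H 0 1) * star (H' 1 1))
      - hankel (star (H 0 1)) (star (H' 1 1)) + hankel (star (H 0 0)) (star (H' 0 1)) := by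
  rw [upperCorner, map_add, Pminus_mulOp_Pplus]
  rfl

/-! ### Linear relations between the factors of the tensors -/

theorem colVec_sub_smul (c : ℂ) (f f' g g' : LInf) :
    colVec (f - c • f') (g - c • g') = colVec f g - c • colVec f' g' := by
  apply col_ext
  · simp only [WithLp.sub_fst, WithLp.smul_fst, colVec_fst, star_sub, star_smul, neg_map_sub,
      neg_map_smul, V_sub, V_smul, star_star]
  · simp only [WithLp.sub_snd, WithLp.smul_snd, colVec_snd, neg_map_sub, neg_map_smul]

theorem rowVec_sub_smul (c : ℂ) (f f' u u' : LInf) :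
    rowVec (f - c • f') (u - c • u') = rowVec f u - star c • rowVec f' u' := by
  apply col_ext
  · change V (neg _) = V (neg _) - star c • V (neg _)
    simp only [neg_map_sub, neg_map_smul, V_sub, V_smul]
  · change neg (star _) = neg (star _) - star c • neg (star _)
    simp only [star_sub, star_smul, neg_map_sub, neg_map_smul]

theorem colVec_smul_sub (c : ℂ) (f f' g g' : LInf) :
    colVec (c • f - f') (c • g - g') = c • colVec f g - colVec f' g' := by
  apply col_ext
  · simp only [WithLp.sub_fst, WithLp.smul_fst, colVec_fst, star_sub, star_smul, neg_map_sub,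
      neg_map_smul, V_sub, V_smul, star_star]
  · simp only [WithLp.sub_snd, WithLp.smul_snd, colVec_snd, neg_map_sub, neg_map_smul]

theorem rowVec_smul_sub (c : ℂ) (f f' u u' : LInf) :
    rowVec (c • f - f') (c • u - u') = star c • rowVec f u - rowVec f' u' := by
  apply col_ext
  · change V (neg _) = star c • V (neg _) - V (neg _)
    simp only [neg_map_sub, neg_map_smul, V_sub, V_smul]
  · change neg (star _) = star c • neg (star _) - neg (star _)
    simp only [star_sub, star_smul, neg_map_sub, neg_map_smul]

theorem colVec_eq_zero_iff (f g : LInf) : colVec f g = 0 ↔ star f ∈ HInf ∧ g ∈ HInf := by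
  rw [← neg_eq_zero_iff, ← neg_eq_zero_iff g, ← V_eq_zero_iff]
  exact ⟨fun h => ⟨congrArg WithLp.fst h, congrArg WithLp.snd h⟩, fun h => col_ext h.1 h.2⟩

theorem rowVec_eq_zero_iff (f u : LInf) : rowVec f u = 0 ↔ f ∈ HInf ∧ star u ∈ HInf := by
  rw [← neg_eq_zero_iff, ← neg_eq_zero_iff (star u), ← V_eq_zero_iff]
  exact ⟨fun h => ⟨congrArg WithLp.fst h, congrArg WithLp.snd h⟩, fun h => col_ext h.1 h.2⟩

theorem colVec_eq_smul_iff (c : ℂ) (f f' g g' : LInf) :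
    colVec f g = c • colVec f' g' ↔ star (f - c • f') ∈ HInf ∧ g - c • g' ∈ HInf := by
  rw [← colVec_eq_zero_iff, colVec_sub_smul, sub_eq_zero]

theorem rowVec_eq_smul_iff (c : ℂ) (f f' u u' : LInf) :
    rowVec f u = star c • rowVec f' u' ↔ f - c • f' ∈ HInf ∧ star (u - c • u') ∈ HInf := by
  rw [← rowVec_eq_zero_iff, rowVec_sub_smul, sub_eq_zero]

theorem rowVec_eq_smul_iff' (c : ℂ) (f f' u u' : LInf) :
    rowVec f u = c • rowVec f' u' ↔ f - star c • f' ∈ HInf ∧ star (u - star c • u') ∈ HInf := by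
  rw [← rowVec_eq_smul_iff, star_star]

theorem tensor_sub_left (p p' q : L2Col) : tensor (p - p') q = tensor p q - tensor p' q := by
  simp [tensor]

theorem tensor_sub_right (p q q' : L2Col) : tensor p (q - q') = tensor p q - tensor p q' := by
  simp [tensor]

theorem tensor_smul_left (c : ℂ) (p q : L2Col) : tensor (c • p) q = c • tensor p q := by
  simp [tensor]

theorem tensor_smul_right (c : ℂ) (p q : L2Col) : tensor p (c • q) = star c • tensor p q := by
  simp [tensor]

/-- The four ways in which `p₁ ⊗ q₁ - p₂ ⊗ q₂` can degenerate to an elementary tensor. -/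
inductive Degeneration : Type
  /-- `p₁` is a multiple of `p₂`. -/
  | colFirst
  /-- `p₂` is a multiple of `p₁`. -/
  | colSecond
  /-- `q₁` is a multiple of `q₂`. -/
  | rowFirst
  /-- `q₂` is a multiple of `q₁`. -/
  | rowSecond

namespace Degeneration

/-- The operator `W H H'` degenerates in the given way, with the factor of proportionality `l`;
this is expressed by two functions in `H^∞`. -/
def Holds (l : ℂ) (H H' : Matrix (Fin 2) (Fin 2) LInf) : Degeneration → Prop
  | colFirst => star (H 0 0 - l • H 0 1) ∈ HInf ∧ H 1 0 - l • H 1 1 ∈ HInf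
  | colSecond => star (H 0 1 - l • H 0 0) ∈ HInf ∧ H 1 1 - l • H 1 0 ∈ HInf
  | rowFirst => H' 0 0 - star l • H' 1 0 ∈ HInf ∧ star (H' 0 1 - star l • H' 1 1) ∈ HInf
  | rowSecond => H' 1 0 - star l • H' 0 0 ∈ HInf ∧ star (H' 1 1 - star l • H' 0 1) ∈ HInf

/-- The two functions whose `colVec` is the left factor of the degenerate `W H H'`. -/
def left (l : ℂ) (H : Matrix (Fin 2) (Fin 2) LInf) (i : Fin 2) : Degeneration → LInf
  | colFirst => H i 1
  | colSecond => H i 0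
  | rowFirst => star l • H i 0 - H i 1
  | rowSecond => H i 0 - star l • H i 1

/-- The two functions whose `rowVec` is the right factor of the degenerate `W H H'`. -/
def right (l : ℂ) (H' : Matrix (Fin 2) (Fin 2) LInf) (j : Fin 2) : Degeneration → LInf
  | colFirst => l • H' 0 j - H' 1 j
  | colSecond => H' 0 j - l • H' 1 j
  | rowFirst => H' 1 j
  | rowSecond => H' 0 j

/-- The part of `lowerCorner H H'` that remains beside the Hankel form of the two factors. -/
def lower (l : ℂ) (H H' : Matrix (Fin 2) (Fin 2) LInf) : Degeneration → LInf
  | colFirst => H 1 0 * H' 0 0 - (H 1 0 - l • H 1 1) * H' 0 0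
  | colSecond => H 1 0 * H' 0 0 + (H 1 1 - l • H 1 0) * H' 1 0
  | rowFirst => H 1 0 * H' 0 0
  | rowSecond => H 1 0 * H' 0 0

/-- The part of `upperCorner H H'` that remains beside the Hankel form of the two factors. -/
def upper (l : ℂ) (H H' : Matrix (Fin 2) (Fin 2) LInf) : Degeneration → LInf
  | colFirst => star (H 0 1) * star (H' 1 1) + star (H 0 0 - l • H 0 1) * star (H' 0 1)
  | colSecond => star (H 0 1) * star (H' 1 1) - star (H 0 1 - l • H 0 0) * star (H' 1 1)
  | rowFirst => star (H 0 1) * star (H' 1 1)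
  | rowSecond => star (H 0 1) * star (H' 1 1)

variable {k : Degeneration} {l : ℂ} {H H' : Matrix (Fin 2) (Fin 2) LInf}

theorem Holds.W_eq (h : k.Holds l H H') :
    W H H' = tensor (colVec (k.left l H 0) (k.left l H 1))
      (rowVec (k.right l H' 0) (k.right l H' 1)) := by
  rw [GSIO.W_eq]
  cases k with
  | colFirst =>
    rw [(colVec_eq_smul_iff _ _ _ _ _).2 h]
    simp only [left, right, rowVec_smul_sub, tensor_smul_left, tensor_sub_right, tensor_smul_right,
      star_star]
  | colSecond =>
    rw [(colVec_eq_smul_iff _ _ _ _ _).2 h]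
    simp only [left, right, rowVec_sub_smul, tensor_smul_left, tensor_sub_right, tensor_smul_right,
      star_star]
  | rowFirst =>
    rw [(rowVec_eq_smul_iff' _ _ _ _ _).2 h]
    simp only [left, right, colVec_smul_sub, tensor_smul_left, tensor_sub_left, tensor_smul_right]
  | rowSecond =>
    rw [(rowVec_eq_smul_iff' _ _ _ _ _).2 h]
    simp only [left, right, colVec_sub_smul, tensor_smul_left, tensor_sub_left, tensor_smul_right]

theorem Holds.lowerCorner_eq (h : k.Holds l H H') :
    lowerCorner H H' = neg (k.lower l H H') - hankel (k.left l H 1) (k.right l H' 0) := by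
  rw [GSIO.lowerCorner_eq]
  cases k with
  | colFirst =>
    rw [hankel_left_of_sub_mem h.2]
    simp only [left, right, lower, neg_map_sub, hankel_sub_right, hankel_smul_right]
    module
  | colSecond =>
    rw [hankel_left_of_sub_mem h.2]
    simp only [left, right, lower, neg_map_add, hankel_sub_right, hankel_smul_right]
    module
  | rowFirst =>
    rw [hankel_right_of_sub_mem _ h.1]
    simp only [left, right, lower, hankel_sub_left, hankel_smul_left]
    module
  | rowSecond =>
    rw [hankel_right_of_sub_mem _ h.1]
    simp only [left, right, lower, hankel_sub_left, hankel_smul_left]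
    module

theorem Holds.upperCorner_eq (h : k.Holds l H H') :
    upperCorner H H'
      = neg (k.upper l H H') + hankel (star (k.left l H 0)) (star (k.right l H' 1)) := by
  rw [GSIO.upperCorner_eq_hankel]
  cases k with
  | colFirst =>
    have h1 := h.1
    simp only [left, right, upper, star_sub, star_smul] at h1 ⊢
    rw [hankel_left_of_sub_mem h1]
    simp only [neg_map_add, hankel_sub_right, hankel_smul_right]
    module
  | colSecond =>
    have h1 := h.1
    simp only [left, right, upper, star_sub, star_smul] at h1 ⊢
    rw [hankel_left_of_sub_mem h1]
    simp only [neg_map_sub, hankel_sub_right, hankel_smul_right]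
    module
  | rowFirst =>
    have h2 := h.2
    simp only [left, right, upper, star_sub, star_smul] at h2 ⊢
    rw [hankel_right_of_sub_mem _ h2]
    simp only [hankel_sub_left, hankel_smul_left]
    module
  | rowSecond =>
    have h2 := h.2
    simp only [left, right, upper, star_sub, star_smul] at h2 ⊢
    rw [hankel_right_of_sub_mem _ h2]
    simp only [hankel_sub_left, hankel_smul_left]
    module

/-- A rank one tensor difference degenerates in one of the four ways. -/
theorem exists_holds (h : IsRankOne (W H H')) : ∃ (k : Degeneration) (l : ℂ), k.Holds l H H' := by
  have := dependent_of_finrank_range_eq_one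
    (T := (W H H' : L2Col →ₗ[ℂ] L2Col)) (fun x => W_apply H H' x) h
  rcases this with ⟨l, hl⟩ | ⟨l, hl⟩ | ⟨l, hl⟩ | ⟨l, hl⟩
  · exact ⟨colFirst, l, (colVec_eq_smul_iff _ _ _ _ _).1 hl⟩
  · exact ⟨colSecond, l, (colVec_eq_smul_iff _ _ _ _ _).1 hl⟩
  · exact ⟨rowFirst, l, (rowVec_eq_smul_iff' _ _ _ _ _).1 hl⟩
  · exact ⟨rowSecond, l, (rowVec_eq_smul_iff' _ _ _ _ _).1 hl⟩

/-- The linear conditions expressing that the elementary tensors to which `W H H'` and `W H' H`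
degenerate have proportional factors, with the factor of proportionality `α`. -/
def Match (k k' : Degeneration) (l μ α : ℂ) (H H' : Matrix (Fin 2) (Fin 2) LInf) : Prop :=
  star (k.left l H 0 - α • k'.left μ H' 0) ∈ HInf ∧ k.left l H 1 - α • k'.left μ H' 1 ∈ HInf ∧
    k'.right μ H 0 - α • k.right l H' 0 ∈ HInf ∧ star (k'.right μ H 1 - α • k.right l H' 1) ∈ HInf

/-- The function whose antianalytic part is `lowerCorner H H' - lowerCorner H' H`. -/
def lowerSymbol (k k' : Degeneration) (l μ α : ℂ) (H H' : Matrix (Fin 2) (Fin 2) LInf) : LInf :=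
  k.lower l H H' - k'.lower μ H' H - (k.left l H 1 - α • k'.left μ H' 1) * k.right l H' 0

/-- The function whose antianalytic part is `upperCorner H H' - upperCorner H' H`. -/
def upperSymbol (k k' : Degeneration) (l μ α : ℂ) (H H' : Matrix (Fin 2) (Fin 2) LInf) : LInf :=
  k.upper l H H' - k'.upper μ H' H
    + star (k.left l H 0 - α • k'.left μ H' 0) * star (k.right l H' 1)

variable {k' : Degeneration} {μ α : ℂ}

/-- Proportional factors, with constants `α` and its conjugate on the two sides, give equal
tensors. -/
theorem Match.W_eq_W (h : k.Holds l H H') (h' : k'.Holds μ H' H) (hm : Match k k' l μ α H H') :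
    W H H' = W H' H := by
  rw [h.W_eq, h'.W_eq, (colVec_eq_smul_iff α _ _ _ _).2 ⟨hm.1, hm.2.1⟩,
    (rowVec_eq_smul_iff α _ _ _ _).2 hm.2.2, tensor_smul_left, tensor_smul_right, star_star]

theorem exists_match (h : k.Holds l H H') (h' : k'.Holds μ H' H) (hW : W H H' = W H' H)
    (h0 : W H H' ≠ 0) : ∃ α : ℂ, α ≠ 0 ∧ Match k k' l μ α H H' := by
  rw [h.W_eq, h'.W_eq] at hW
  rw [h.W_eq] at h0
  obtain ⟨α, hα, h1, h2⟩ := exists_smul_of_tensor_eq hW h0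
  have h3 := (colVec_eq_smul_iff _ _ _ _ _).1 h1
  exact ⟨α, hα, h3.1, h3.2, (rowVec_eq_smul_iff _ _ _ _ _).1 h2⟩

theorem Match.lowerCorner_sub (h : k.Holds l H H') (h' : k'.Holds μ H' H)
    (hm : Match k k' l μ α H H') :
    lowerCorner H H' - lowerCorner H' H = neg (lowerSymbol k k' l μ α H H') := by
  rw [h.lowerCorner_eq, h'.lowerCorner_eq, hankel_right_of_sub_mem _ hm.2.2.1,
    hankel_left_of_sub_mem hm.2.1, lowerSymbol, neg_map_sub, neg_map_sub]
  abel

theorem Match.upperCorner_sub (h : k.Holds l H H') (h' : k'.Holds μ H' H)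
    (hm : Match k k' l μ α H H') :
    upperCorner H H' - upperCorner H' H = neg (upperSymbol k k' l μ α H H') := by
  have h1 := hm.1
  have h2 := hm.2.2.2
  rw [star_sub, star_smul] at h1 h2
  rw [h.upperCorner_eq, h'.upperCorner_eq, hankel_right_of_sub_mem _ h2,
    hankel_left_of_sub_mem h1, upperSymbol, neg_map_add, neg_map_sub, star_sub, star_smul]
  abel

theorem Match.commute_iff (h : k.Holds l H H') (h' : k'.Holds μ H' H)
    (hm : Match k k' l μ α H H') :
    gsio H ∘L gsio H' = gsio H' ∘L gsio H ↔
      lowerSymbol k k' l μ α H H' ∈ HInf ∧ upperSymbol k k' l μ α H H' ∈ HInf := by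
  rw [GSIO.commute_iff, and_iff_right (hm.W_eq_W h h'), ← neg_eq_zero_iff, ← neg_eq_zero_iff,
    ← hm.lowerCorner_sub h h', ← hm.upperCorner_sub h h', sub_eq_zero, sub_eq_zero]

/-- All the conditions on the symbols that go with given degenerations of the two tensors. -/
def Conditions (k k' : Degeneration) (l μ α : ℂ) (H H' : Matrix (Fin 2) (Fin 2) LInf) : Prop :=
  (k.Holds l H H' ∧ k'.Holds μ H' H ∧ Match k k' l μ α H H') ∧
    lowerSymbol k k' l μ α H H' ∈ HInf ∧ upperSymbol k k' l μ α H H' ∈ HInf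

/-- The sixteen conditions in uniform shape, one for each pair of degenerations. -/
theorem commute_iff_exists (h : IsRankOne (W H H')) (h' : IsRankOne (W H' H)) :
    gsio H ∘L gsio H' = gsio H' ∘L gsio H ↔
      ∃ k' k : Degeneration, ∃ l μ α : ℂ, α ≠ 0 ∧ Conditions k k' l μ α H H' := by
  constructor
  · intro hc
    obtain ⟨k, l, hk⟩ := exists_holds h
    obtain ⟨k', μ, hk'⟩ := exists_holds h'
    have h0 : W H H' ≠ 0 := by
      intro h0
      rw [IsRankOne, h0, ContinuousLinearMap.toLinearMap_zero, LinearMap.range_zero,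
        finrank_bot] at h
      exact zero_ne_one h
    obtain ⟨α, hα, hm⟩ := exists_match hk hk' ((GSIO.commute_iff _ _).1 hc).1 h0
    exact ⟨k', k, l, μ, α, hα, ⟨hk, hk', hm⟩, (hm.commute_iff hk hk').1 hc⟩
  · rintro ⟨k', k, l, μ, α, -, ⟨hk, hk', hm⟩, hc⟩
    exact (hm.commute_iff hk hk').2 hc

theorem mem_HInf_congr {a b : LInf} (h : a = b ∨ a = -b) : a ∈ HInf ↔ b ∈ HInf := by
  rcases h with rfl | rfl
  · rfl
  · exact HInf.neg_mem_iff

/-- Assembles one of the lists of ten functions in the theorem, the last two of which need only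
agree up to sign with those of `Conditions`. -/
theorem conditions_iff {r₁ r₂ r₃ r₄ r₅ r₆ r₇ r₈ x y s₁ s₂ s₃ s₄ s₅ s₆ s₇ s₈ x' y' : LInf}
    (h₁ : r₁ = s₁) (h₂ : r₂ = s₂) (h₃ : r₃ = s₃) (h₄ : r₄ = s₄) (h₅ : r₅ = s₅) (h₆ : r₆ = s₆)
    (h₇ : r₇ = s₇) (h₈ : r₈ = s₈) (hx : x = x' ∨ x = -x') (hy : y = y' ∨ y = -y') :
    (((r₁ ∈ HInf ∧ r₂ ∈ HInf) ∧ (r₃ ∈ HInf ∧ r₄ ∈ HInf) ∧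
        r₅ ∈ HInf ∧ r₆ ∈ HInf ∧ r₇ ∈ HInf ∧ r₈ ∈ HInf) ∧ x ∈ HInf ∧ y ∈ HInf)
      ↔ InHInf {s₁, s₂, s₃, s₄, s₅, s₆, s₇, s₈, x', y'} := by
  subst h₁ h₂ h₃ h₄ h₅ h₆ h₇ h₈
  rw [mem_HInf_congr hx, mem_HInf_congr hy]
  simp only [InHInf, Set.mem_insert_iff, Set.mem_singleton_iff, forall_eq_or_imp, forall_eq,
    and_assoc]

/-- The variant of `conditions_iff` for the lists in which the condition on `upperSymbol` precedes
that on `lowerSymbol`. -/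
theorem conditions_iff' {r₁ r₂ r₃ r₄ r₅ r₆ r₇ r₈ x y s₁ s₂ s₃ s₄ s₅ s₆ s₇ s₈ x' y' : LInf}
    (h₁ : r₁ = s₁) (h₂ : r₂ = s₂) (h₃ : r₃ = s₃) (h₄ : r₄ = s₄) (h₅ : r₅ = s₅) (h₆ : r₆ = s₆)
    (h₇ : r₇ = s₇) (h₈ : r₈ = s₈) (hx : x = x' ∨ x = -x') (hy : y = y' ∨ y = -y') :
    (((r₁ ∈ HInf ∧ r₂ ∈ HInf) ∧ (r₃ ∈ HInf ∧ r₄ ∈ HInf) ∧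
        r₅ ∈ HInf ∧ r₆ ∈ HInf ∧ r₇ ∈ HInf ∧ r₈ ∈ HInf) ∧ x ∈ HInf ∧ y ∈ HInf)
      ↔ InHInf {s₁, s₂, s₃, s₄, s₅, s₆, s₇, s₈, y', x'} := by
  rw [and_comm (a := x ∈ HInf)]
  exact conditions_iff h₁ h₂ h₃ h₄ h₅ h₆ h₇ h₈ hy hx

theorem exists_iff {p : Degeneration → Prop} :
    (∃ k, p k) ↔ p colFirst ∨ p colSecond ∨ p rowFirst ∨ p rowSecond := by
  constructor
  · rintro ⟨_ | _ | _ | _, h⟩ <;> tauto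
  · rintro (h | h | h | h) <;> exact ⟨_, h⟩

end Degeneration

end GSIO

end

/-- Commuting generalized Cauchy singular integral operators, when both sides of the tensor equation
`W H₁ H₂ = W H₂ H₁` are operators of rank one (neither the equality of the two sides nor any
relation between the symbols is assumed). Here `l`, `μ`, `α` are the constants of each condition,
only `α` being required to be nonzero, and `star` is complex conjugation, of symbols and of
constants. -/
theorem theorem4p5 (f₁ g₁ u₁ v₁ f₂ g₂ u₂ v₂ : GSIO.LInf)
    (hl : GSIO.IsRankOne (GSIO.W !![f₁, u₁; g₁, v₁] !![f₂, u₂; g₂, v₂]))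
    (hr : GSIO.IsRankOne (GSIO.W !![f₂, u₂; g₂, v₂] !![f₁, u₁; g₁, v₁])) :
    GSIO.gsio !![f₁, u₁; g₁, v₁] ∘L GSIO.gsio !![f₂, u₂; g₂, v₂]
        = GSIO.gsio !![f₂, u₂; g₂, v₂] ∘L GSIO.gsio !![f₁, u₁; g₁, v₁] ↔
  -- (1)
  (∃ l μ α : ℂ, α ≠ 0 ∧ GSIO.InHInf {
    star f₁ - star l • star u₁, g₁ - l • v₁, star f₂ - star μ • star u₂, g₂ - μ • v₂,
    star u₁ - star α • star u₂, v₁ - α • v₂,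
    μ • f₁ - g₁ - α • (l • f₂ - g₂), star μ • star u₁ - star v₁ - star α • (star l • star u₂ - star v₂),
    g₂ * (v₁ - α • v₂) + v₂ * ((α * l) • f₂ - μ • f₁),
    star u₂ * star f₁ - star u₁ * star f₂ + star μ • (star u₁ * star u₂) - star v₁ * star u₂ + star α • (star v₂ * star u₂) - (star l * star α) • (star u₂ * star u₂)}) ∨
  -- (2)
  (∃ l μ α : ℂ, α ≠ 0 ∧ GSIO.InHInf {
    star u₁ - star l • star f₁, v₁ - l • g₁, star f₂ - star μ • star u₂, g₂ - μ • v₂,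
    star f₁ - star α • star u₂, g₁ - α • v₂,
    μ • f₁ - g₁ - α • (f₂ - l • g₂), star μ • star u₁ - star v₁ - star α • (star u₂ - star l • star v₂),
    g₂ * (v₁ - (l * α) • v₂) + v₂ * (α • f₂ - μ • f₁),
    star u₂ * star f₁ - star u₁ * star f₂ - star α • (star u₂ * star u₂) + (star l * star α) • (star v₂ * star u₂) + star μ • (star u₁ * star u₂) - star v₁ * star u₂}) ∨
  -- (3)
  (∃ l μ α : ℂ, α ≠ 0 ∧ GSIO.InHInf {
    f₂ - star l • g₂, star u₂ - l • star v₂, star f₂ - star μ • star u₂, g₂ - μ • v₂,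
    l • star f₁ - star u₁ - star α • star u₂, star l • g₁ - v₁ - α • v₂,
    μ • f₁ - g₁ - α • g₂, star μ • star u₁ - star v₁ - star α • star v₂,
    g₁ * f₂ + v₁ * g₂ - star l • (g₁ * g₂) + α • (v₂ * g₂) - μ • (v₂ * f₁),
    l • (star v₂ * star f₁) + star μ • (star u₁ * star u₂) - star v₁ * star u₂ - star α • (star v₂ * star u₂) - star u₁ * star f₂}) ∨
  -- (4)
  (∃ l μ α : ℂ, α ≠ 0 ∧ GSIO.InHInf {
    g₂ - star l • f₂, star v₂ - l • star u₂, star f₂ - star μ • star u₂, g₂ - μ • v₂,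
    star f₁ - l • star u₁ - star α • star u₂, g₁ - star l • v₁ - α • v₂,
    μ • f₁ - g₁ - α • f₂, star μ • star u₁ - star v₁ - star α • star u₂,
    star l • (v₁ * f₂) - μ • (v₂ * f₁) + α • (v₂ * f₂),
    star v₂ * star u₁ - star u₁ * star f₂ + star u₂ * star f₁ - l • (star u₁ * star u₂) + star μ • (star u₁ * star u₂) - star u₂ * star v₁ - star α • (star u₂ * star u₂)}) ∨
  -- (5)
  (∃ l μ α : ℂ, α ≠ 0 ∧ GSIO.InHInf {
    star f₁ - star l • star u₁, g₁ - l • v₁, star u₂ - star μ • star f₂, v₂ - μ • g₂,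
    star u₁ - star α • star f₂, v₁ - α • g₂,
    f₁ - μ • g₁ - α • (l • f₂ - g₂), star u₁ - star μ • star v₁ - star α • (star l • star u₂ - star v₂),
    star u₂ * star f₁ - star μ • (star v₁ * star f₂) + star α • (star v₂ * star f₂) - (star l * star α) • (star u₂ * star f₂),
    v₁ * g₂ - v₂ * g₁ - f₁ * g₂ + μ • (g₁ * g₂) - α • (g₂ * g₂) + (l * α) • (g₂ * f₂)}) ∨
  -- (6)
  (∃ l μ α : ℂ, α ≠ 0 ∧ GSIO.InHInf {
    star u₁ - star l • star f₁, v₁ - l • g₁, star u₂ - star μ • star f₂, v₂ - μ • g₂,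
    star f₁ - star α • star f₂, g₁ - α • g₂,
    f₁ - μ • g₁ - α • (f₂ - l • g₂), star u₁ - star μ • star v₁ - star α • (star u₂ - star l • star v₂),
    star u₂ * star f₁ - star μ • (star v₁ * star f₂) - star α • (star u₂ * star f₂) + (star l * star α) • (star v₂ * star f₂),
    v₁ * g₂ - v₂ * g₁ - g₂ * f₁ + μ • (g₁ * g₂) + α • (g₂ * f₂) - (l * α) • (g₂ * g₂)}) ∨
  -- (7)
  (∃ l μ α : ℂ, α ≠ 0 ∧ GSIO.InHInf {
    f₂ - star l • g₂, star u₂ - l • star v₂, star u₂ - star μ • star f₂, v₂ - μ • g₂,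
    l • star f₁ - star u₁ - star α • star f₂, star l • g₁ - v₁ - α • g₂,
    f₁ - μ • g₁ - α • g₂, star u₁ - star μ • star v₁ - star α • star v₂,
    l • (star v₂ * star f₁) - star μ • (star v₁ * star f₂) - star α • (star v₂ * star f₂),
    g₁ * f₂ - v₂ * g₁ + (v₁ - star l • g₁) * g₂ + g₂ * (μ • g₁ - f₁) + α • (g₂ * g₂)}) ∨
  -- (8)
  (∃ l μ α : ℂ, α ≠ 0 ∧ GSIO.InHInf {
    g₂ - star l • f₂, star v₂ - l • star u₂, star u₂ - star μ • star f₂, v₂ - μ • g₂,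
    star f₁ - l • star u₁ - star α • star f₂, g₁ - star l • v₁ - α • g₂,
    f₁ - μ • g₁ - α • f₂, star u₁ - star μ • star v₁ - star α • star u₂,
    star v₂ * star u₁ + star u₂ * star f₁ - l • (star u₁ * star u₂) - star μ • (star v₁ * star f₂) - star α • (star u₂ * star f₂),
    g₁ * v₂ + g₂ * f₁ - star l • (v₁ * f₂) - μ • (g₁ * g₂) - α • (g₂ * f₂)}) ∨
  -- (9)
  (∃ l μ α : ℂ, α ≠ 0 ∧ GSIO.InHInf {
    star f₁ - star l • star u₁, g₁ - l • v₁, f₁ - star μ • g₁, star u₁ - μ • star v₁,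
    star u₁ - star α • (μ • star f₂ - star u₂), v₁ - α • (star μ • g₂ - v₂),
    g₁ - α • (l • f₂ - g₂), star v₁ - star α • (star l • star u₂ - star v₂),
    star u₂ * star f₁ - star v₁ * star u₂ + star α • ((star l • star u₂ - star v₂) * (star u₂ - μ • star f₂)),
    v₁ * g₂ - g₂ * f₁ + α • ((star μ • g₂ - v₂) * (l • f₂ - g₂))}) ∨
  -- (10)
  (∃ l μ α : ℂ, α ≠ 0 ∧ GSIO.InHInf {
    star u₁ - star l • star f₁, v₁ - l • g₁, f₁ - star μ • g₁, star u₁ - μ • star v₁,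
    star f₁ - star α • (μ • star f₂ - star u₂), g₁ - α • (star μ • g₂ - v₂),
    g₁ - α • (f₂ - l • g₂), star v₁ - star α • (star u₂ - star l • star v₂),
    star u₂ * star f₁ - star v₁ * star u₂ + star α • ((star l • star v₂ - star u₂) * (μ • star f₂ - star u₂)),
    v₁ * g₂ - g₂ * f₁ + α • ((star μ • g₂ - v₂) * (f₂ - l • g₂))}) ∨
  -- (11)
  (∃ l μ α : ℂ, α ≠ 0 ∧ GSIO.InHInf {
    f₂ - star l • g₂, star u₂ - l • star v₂, f₁ - star μ • g₁, star u₁ - μ • star v₁,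
    l • star f₁ - star u₁ - star α • (μ • star f₂ - star u₂), star l • g₁ - v₁ - α • (star μ • g₂ - v₂),
    g₁ - α • g₂, star v₁ - star α • star v₂,
    star v₁ * star u₂ - l • (star v₂ * star f₁) - star α • (star v₂ * star u₂) + (star α * μ) • (star v₂ * star f₂),
    g₁ * f₂ - g₂ * f₁ + (v₁ - star l • g₁) * g₂ + α • (g₂ * (star μ • g₂ - v₂))}) ∨
  -- (12)
  (∃ l μ α : ℂ, α ≠ 0 ∧ GSIO.InHInf {
    g₂ - star l • f₂, star v₂ - l • star u₂, f₁ - star μ • g₁, star u₁ - μ • star v₁,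
    star f₁ - l • star u₁ - star α • (μ • star f₂ - star u₂), g₁ - star l • v₁ - α • (star μ • g₂ - v₂),
    g₁ - α • f₂, star v₁ - star α • star u₂,
    star v₂ * star u₁ - star v₁ * star u₂ + star u₂ * (star f₁ - l • star u₁) + star α • (star u₂ * (star u₂ - μ • star f₂)),
    g₂ * f₁ - star l • (v₁ * f₂) - (star μ * α) • (f₂ * g₂) + α • (v₂ * f₂)}) ∨
  -- (13)
  (∃ l μ α : ℂ, α ≠ 0 ∧ GSIO.InHInf {
    star f₁ - star l • star u₁, g₁ - l • v₁, g₁ - star μ • f₁, star v₁ - μ • star u₁,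
    star u₁ - star α • (star f₂ - μ • star u₂), v₁ - α • (g₂ - star μ • v₂),
    f₁ - α • (l • f₂ - g₂), star u₁ - star α • (star l • star u₂ - star v₂),
    star u₂ * star f₁ - star v₁ * star u₂ + star α • ((star v₂ - star l • star u₂) * (star f₂ - μ • star u₂)),
    v₁ * g₂ - g₂ * f₁ + α • ((g₂ - star μ • v₂) * (l • f₂ - g₂))}) ∨
  -- (14)
  (∃ l μ α : ℂ, α ≠ 0 ∧ GSIO.InHInf {
    star u₁ - star l • star f₁, v₁ - l • g₁, g₁ - star μ • f₁, star v₁ - μ • star u₁,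
    star f₁ - star α • (star f₂ - μ • star u₂), g₁ - α • (g₂ - star μ • v₂),
    f₁ - α • (f₂ - l • g₂), star u₁ - star α • (star u₂ - star l • star v₂),
    (star f₁ - star v₁) * star u₂ + star α • ((star l • star v₂ - star u₂) * (star f₂ - μ • star u₂)),
    (v₁ - f₁) * g₂ + α • ((g₂ - star μ • v₂) * (f₂ - l • g₂))}) ∨
  -- (15)
  (∃ l μ α : ℂ, α ≠ 0 ∧ GSIO.InHInf {
    f₂ - star l • g₂, star u₂ - l • star v₂, g₁ - star μ • f₁, star v₁ - μ • star u₁,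
    l • star f₁ - star u₁ - star α • (star f₂ - μ • star u₂), star l • g₁ - v₁ - α • (g₂ - star μ • v₂),
    f₁ - α • g₂, star u₁ - star α • star v₂,
    star v₁ * star u₂ - l • (star f₁ * star v₂) - star α • (star v₂ * (μ • star u₂ - star f₂)),
    g₁ * f₂ - g₂ * f₁ + (v₁ - star l • g₁) * g₂ + α • (g₂ * (g₂ - star μ • v₂))}) ∨
  -- (16)
  (∃ l μ α : ℂ, α ≠ 0 ∧ GSIO.InHInf {
    g₂ - star l • f₂, star v₂ - l • star u₂, g₁ - star μ • f₁, star v₁ - μ • star u₁,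
    star f₁ - l • star u₁ - star α • (star f₂ - μ • star u₂), g₁ - star l • v₁ - α • (g₂ - star μ • v₂),
    f₁ - α • f₂, star u₁ - star α • star u₂,
    star u₁ * star v₂ - star v₁ * star u₂ + star u₂ * (star f₁ - l • star u₁) + star α • (star u₂ * (μ • star u₂ - star f₂)),
    f₁ * g₂ - star l • (v₁ * f₂) + α • (f₂ * (star μ • v₂ - g₂))}) := by
  rw [GSIO.Degeneration.commute_iff_exists hl hr]
  simp only [GSIO.Degeneration.exists_iff, or_assoc]
  -- The cases appear in the order of the sixteen lists, the degeneration of `W H₁ H₂` varying faster.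
  refine or_congr ?_ <| or_congr ?_ <| or_congr ?_ <| or_congr ?_ <| or_congr ?_ <|
    or_congr ?_ <| or_congr ?_ <| or_congr ?_ <| or_congr ?_ <| or_congr ?_ <| or_congr ?_ <|
    or_congr ?_ <| or_congr ?_ <| or_congr ?_ <| or_congr ?_ ?_
  -- Only the first four lists put the condition coming from `lowerCorner` first.
  iterate 4
    on_goal 1 =>
    refine exists_congr fun l => exists_congr fun μ => exists_congr fun α =>
      and_congr_right fun _ =>
        GSIO.Degeneration.conditions_iff ?_ ?_ ?_ ?_ ?_ ?_ ?_ ?_ ?_ ?_ <;>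
    simp only [GSIO.Degeneration.left, GSIO.Degeneration.right, GSIO.Degeneration.lower,
      GSIO.Degeneration.upper, GSIO.Degeneration.lowerSymbol, GSIO.Degeneration.upperSymbol,
      Matrix.of_apply, Matrix.cons_val', Matrix.cons_val_zero, Matrix.cons_val_one,
      Matrix.cons_val_fin_one, star_sub, star_smul, star_star] <;>
    simp only [Algebra.smul_def, map_mul] <;>
    first | ring1 | exact Or.inl (by ring1)
  all_goals
    refine exists_congr fun l => exists_congr fun μ => exists_congr fun α =>
      and_congr_right fun _ =>
        GSIO.Degeneration.conditions_iff' ?_ ?_ ?_ ?_ ?_ ?_ ?_ ?_ ?_ ?_ <;>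
    simp only [GSIO.Degeneration.left, GSIO.Degeneration.right, GSIO.Degeneration.lower,
      GSIO.Degeneration.upper, GSIO.Degeneration.lowerSymbol, GSIO.Degeneration.upperSymbol,
      Matrix.of_apply, Matrix.cons_val', Matrix.cons_val_zero, Matrix.cons_val_one,
      Matrix.cons_val_fin_one, star_sub, star_smul, star_star] <;>
    simp only [Algebra.smul_def, map_mul] <;>
    first | ring1 | exact Or.inl (by ring1) | exact Or.inr (by ring1)
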